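/- Let $p_0=(0,0)$, $p_1=(1,0)$, $p_2=(\tfrac12,\tfrac{\sqrt3}{2})$, $f_i(x)=(x+p_i)/2$ on $\mathbb{R}^2$ for $i=0,1,2$, and let $K$ be the Sierpiński gasket, the unique non-empty compact set with $K=f_0(K)\cup f_1(K)\cup f_2(K)$. Put $\alpha=\log3/\log2$, $\beta^*=\log5/\log2$, and let $\nu$ be the normalized $\alpha$-dimensional Hausdorff measure on $K$. For a word $w=w_1\ldots w_n\in W_n=\{0,1,2\}^n$ put $f_w=f_{w_1}\circ\dots\circ f_{w_n}$, $K_w=f_w(K)$, $V_w=\{f_w(p_0),f_w(p_1),f_w(p_2)\}$. For a function $u$ on $K$ the quantities $\left(\frac53\right)^n\sum_{w\in W_n}\sum_{p,q\in V_w}(u(p)-u(q))^2$ (sums over ordered pairs) increase with $n$; let $$\mathcal E_{\mathrm{loc}}(u,u)=\lim_{n\to\infty}\left(\tfrac53\right)^n\sum_{w\in W_n}\sum_{p,q\in V_w}(u(p)-u(q))^2\in[0,\infty],\qquad \mathcal F_{\mathrm{loc}}=\{u\in C(K):\mathcal E_{\mathrm{loc}}(u,u)<\infty\}.$$ Let $\gamma\ge1$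 be an integer. For integers $n,i\ge1$, $w\in W_n$ and $p=f_w(p_j)\in V_w$ let $K^{(i)}_{p,n}=K_{wj\ldots j}$ with $\gamma ni$ letters $j$ appended to $w$ (this set depends on $w$ as well as on $p$). Theorem. Let $(\beta_i)_{i\ge1}\subseteq(\alpha,\beta^*)$ with $\beta_i\uparrow\beta^*$. Then there are non-decreasing functions $\Phi:\mathbb N\to\mathbb N$ with $(1-5^{-1}\cdot2^{\beta_i})\Phi(i)\ge i$ for all $i\ge1$. For every such $\Phi$ and every sequence $(\delta_i)_{i\ge1}\subseteq(0,1)$ with $\delta_i\uparrow1$, put $$C_i(x,y)=\sum_{n=1}^{\Phi(i)}2^{-2\alpha n}\sum_{w\in W_n}\sum_{\substack{p,q\in V_w\\p\neq q}}\frac{1}{\nu(K^{(i)}_{p,n})\,\nu(K^{(i)}_{q,n})}1_{K^{(i)}_{p,n}}(x)1_{K^{(i)}_{q,n}}(y),\qquad a_i=\delta_iC_i+(1-\delta_i).$$ Then for each $i\ge1$ the function $a_i$ is bounded from above and below on $K\times K$ by positive constants (which may depend on $i$), and for every $u\in\mathcal F_{\mathrm{loc}}$ $$\lim_{i\to\infty}\left(1-5^{-1}\cdot2^{\beta_i}\right)\iint_{(K\times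 K)\setminus\mathrm{diag}}\frac{a_i(x,y)(u(x)-u(y))^2}{|x-y|^{\alpha+\beta_i}}\,\nu(\mathrm dx)\,\nu(\mathrm dy)=\mathcal E_{\mathrm{loc}}(u,u).$$ -/

import Mathlib

open Set Filter Topology MeasureTheory
open scoped ENNReal

noncomputable section

namespace SierpinskiGasket

/-- The Euclidean plane. -/
abbrev Plane : Type := EuclideanSpace ℝ (Fin 2)

/-- The corners `p₀ = (0,0)`, `p₁ = (1,0)`, `p₂ = (1/2, √3/2)`. -/
def corner : Fin 3 → Plane :=
  ![!₂[0, 0], !₂[1, 0], !₂[1 / 2, Real.sqrt 3 / 2]]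

/-- The contractions `fᵢ(x) = (x + pᵢ) / 2`. -/
def contr (i : Fin 3) (x : Plane) : Plane := (1 / 2 : ℝ) • (x + corner i)

/-- The finite vertex sets `V₀ = {p₀, p₁, p₂}`, `Vₙ₊₁ = f₀(Vₙ) ∪ f₁(Vₙ) ∪ f₂(Vₙ)`. -/
def vertexSet : ℕ → Set Plane
  | 0 => range corner
  | n + 1 => ⋃ i, contr i '' vertexSet n

/-- The Sierpinski gasket `K`, the closure of the set of all vertices. The facts `gasket_isCompact`,
`gasket_nonempty`, `gasket_selfSimilar` and `eq_gasket` below show that it is the unique non-empty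
compact set with `K = f₀(K) ∪ f₁(K) ∪ f₂(K)`. -/
def gasket : Set Plane := closure (⋃ n, vertexSet n)

/-- `f_w = f_{w₁} ∘ ⋯ ∘ f_{wₙ}` for a word `w = w₁ … wₙ`, with `f_∅ = id`. -/
def wordMap : List (Fin 3) → Plane → Plane
  | [] => id
  | i :: w => contr i ∘ wordMap w

/-- The cell `K_w = f_w(K)`. -/
def cell (w : List (Fin 3)) : Set Plane := wordMap w '' gasket

/-- The Hausdorff dimension `α = log 3 / log 2` of the gasket. -/
def hdim : ℝ := Real.log 3 / Real.log 2

/-- The walk dimension `β* = log 5 / log 2` of the gasket. -/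
def walkDim : ℝ := Real.log 5 / Real.log 2

/-- The normalized Hausdorff measure of dimension `α` on the gasket. -/
def hausdorffProb : Measure Plane :=
  (μH[hdim] gasket)⁻¹ • (μH[hdim]).restrict gasket

/-- The energy `(5/3)ⁿ ∑_{w ∈ Wₙ} ∑_{p, q ∈ V_w} (u(p) - u(q))²` of level `n`. The set `V_w` has the
three distinct elements `f_w(p₀), f_w(p₁), f_w(p₂)`, and the sum runs over ordered pairs. -/
def discreteEnergy (n : ℕ) (u : Plane → ℝ) : ℝ :=
  (5 / 3) ^ n * ∑ w : Fin n → Fin 3, ∑ j : Fin 3, ∑ k : Fin 3,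
    (u (wordMap (List.ofFn w) (corner j)) - u (wordMap (List.ofFn w) (corner k))) ^ 2

/-- The local energy `lim_n` of the energies of level `n`, with values in `[0, ∞]`. The limit always
exists, see `tendsto_localEnergy`. -/
def localEnergy (u : Plane → ℝ) : ℝ≥0∞ :=
  limUnder atTop fun n : ℕ => ENNReal.ofReal (discreteEnergy n u)

/-- The domain of the local energy: continuous functions on the gasket with finite local energy
(values of `u` outside of the gasket play no role). -/
def localDomain : Set (Plane → ℝ) :=
  {u | ContinuousOn u gasket ∧ localEnergy u < ∞}

/-- For a word `w` of length `n` and the vertex `p = f_w(p_j)` in `V_w`, the small cell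
`K_{w j … j}` at `p`, with `γ n i` letters `j`. -/
def cornerCell (γ i : ℕ) {n : ℕ} (w : Fin n → Fin 3) (j : Fin 3) : Set Plane :=
  cell (List.ofFn w ++ List.replicate (γ * n * i) j)

/-- The kernel
`C(x,y) = ∑_{n=1}^{N} 2^{-2αn} ∑_{w ∈ Wₙ} ∑_{p, q ∈ V_w, p ≠ q} 1_{K_p}(x) 1_{K_q}(y) / (ν(K_p) ν(K_q))`,
where `K_p` is the small cell at the vertex `p` of `K_w`. -/
def vertexKernel (γ N i : ℕ) (x y : Plane) : ℝ :=
  ∑ n ∈ Finset.Icc 1 N, (2 : ℝ) ^ (-2 * hdim * (n : ℝ)) *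
    ∑ w : Fin n → Fin 3, ∑ j : Fin 3, ∑ k ∈ Finset.univ.filter (fun k : Fin 3 => k ≠ j),
      1 / (hausdorffProb.real (cornerCell γ i w j) * hausdorffProb.real (cornerCell γ i w k)) *
        ((cornerCell γ i w j).indicator (fun _ => (1 : ℝ)) x *
          (cornerCell γ i w k).indicator (fun _ => (1 : ℝ)) y)

/-- `a(x,y) = δ C(x,y) + (1 - δ)`. -/
def jumpKernel (γ N i : ℕ) (δ : ℝ) (x y : Plane) : ℝ :=
  δ * vertexKernel γ N i x y + (1 - δ)

/-- The non-local energy `∬_{K×K∖diag} a(x,y) (u(x)-u(y))² / |x-y|^{α+β} ν(dx) ν(dy)`, with values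
in `[0, ∞]`. -/
def jumpEnergy (a : Plane → Plane → ℝ) (β : ℝ) (u : Plane → ℝ) : ℝ≥0∞ :=
  ∫⁻ z in (gasket ×ˢ gasket) \ diagonal Plane,
    ENNReal.ofReal (a z.1 z.2 * (u z.1 - u z.2) ^ 2 / dist z.1 z.2 ^ (hdim + β))
    ∂(hausdorffProb.prod hausdorffProb)

/-! The gasket is the unique non-empty compact set `K` with `K = f₀(K) ∪ f₁(K) ∪ f₂(K)`. -/

lemma contr_corner (i : Fin 3) : contr i (corner i) = corner i := by
  simp only [contr]; rw [← two_smul ℝ (corner i), smul_smul]; norm_num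

lemma contr_corner_comm (i j : Fin 3) : contr i (corner j) = contr j (corner i) := by
  simp only [contr, add_comm]

lemma dist_contr (i : Fin 3) (x y : Plane) : dist (contr i x) (contr i y) = 1 / 2 * dist x y := by
  simp only [contr, dist_smul₀, dist_add_right]; norm_num

lemma continuous_contr (i : Fin 3) : Continuous (contr i) := by
  unfold contr; fun_prop

lemma dist_iterate_contr (i : Fin 3) (x y : Plane) (n : ℕ) :
    dist ((contr i)^[n] x) ((contr i)^[n] y) = (1 / 2) ^ n * dist x y := by
  induction n with
  | zero => simp
  | succ n ih => rw [Function.iterate_succ_apply', Function.iterate_succ_apply', dist_contr, ih]; ring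

lemma vertexSet_succ_subset (n : ℕ) : vertexSet n ⊆ vertexSet (n + 1) := by
  induction n with
  | zero =>
    rintro _ ⟨i, rfl⟩
    exact mem_iUnion.2 ⟨i, corner i, mem_range_self i, contr_corner i⟩
  | succ n ih => exact iUnion_mono fun i => image_mono ih

lemma norm_corner_le (i : Fin 3) : ‖corner i‖ ≤ 1 := by
  rw [EuclideanSpace.norm_eq, Real.sqrt_le_one]
  fin_cases i
  · simp [corner]
  · simp [corner]
  · have := Real.sq_sqrt (show (0 : ℝ) ≤ 3 by norm_num)
    simp [corner, div_pow, this]; norm_num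

lemma vertexSet_subset_ball (n : ℕ) : vertexSet n ⊆ Metric.closedBall 0 1 := by
  induction n with
  | zero =>
    rintro _ ⟨i, rfl⟩
    simpa using norm_corner_le i
  | succ n ih =>
    intro x hx
    obtain ⟨i, y, hy, rfl⟩ := mem_iUnion.1 hx
    have h1 : ‖y‖ ≤ 1 := by simpa using ih hy
    have h2 := norm_add_le y (corner i)
    have h3 := norm_corner_le i
    simp only [contr, mem_closedBall_zero_iff, norm_smul]
    norm_num
    linarith

theorem gasket_isCompact : IsCompact gasket :=
  (isCompact_closedBall (0 : Plane) 1).of_isClosed_subset isClosed_closure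
    (closure_minimal (iUnion_subset vertexSet_subset_ball) Metric.isClosed_closedBall)

theorem gasket_nonempty : gasket.Nonempty :=
  ⟨corner 0, subset_closure (mem_iUnion.2 ⟨0, mem_range_self 0⟩)⟩

theorem gasket_selfSimilar : gasket = ⋃ i, contr i '' gasket := by
  apply Subset.antisymm
  · refine closure_minimal (iUnion_subset fun n => ?_)
      (isClosed_iUnion_of_finite fun i =>
        (gasket_isCompact.image (continuous_contr i)).isClosed)
    refine (vertexSet_succ_subset n).trans (iUnion_mono fun i => image_mono ?_)
    exact (subset_iUnion _ n).trans subset_closure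
  · refine iUnion_subset fun i => ?_
    refine (image_closure_subset_closure_image (continuous_contr i)).trans (closure_mono ?_)
    rintro _ ⟨x, hx, rfl⟩
    obtain ⟨n, hn⟩ := mem_iUnion.1 hx
    exact mem_iUnion.2 ⟨n + 1, mem_iUnion.2 ⟨i, x, hn, rfl⟩⟩

theorem eq_gasket (K : Set Plane) (hne : K.Nonempty) (hK : IsCompact K)
    (hself : K = ⋃ i, contr i '' K) : K = gasket := by
  have hmap : ∀ i, ∀ x ∈ K, contr i x ∈ K := fun i x hx => by
    rw [hself]; exact mem_iUnion.2 ⟨i, x, hx, rfl⟩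
  apply Subset.antisymm
  · obtain ⟨R, hR⟩ := (hK.isBounded.subset_closedBall (corner 0))
    have key : ∀ n : ℕ, ∀ x ∈ K, ∃ v ∈ vertexSet n, dist x v ≤ (1 / 2) ^ n * R := by
      intro n
      induction n with
      | zero => exact fun x hx => ⟨corner 0, mem_range_self 0, by simpa using hR hx⟩
      | succ n ih =>
        intro x hx
        rw [hself] at hx
        obtain ⟨i, y, hy, rfl⟩ := mem_iUnion.1 hx
        obtain ⟨v, hv, hd⟩ := ih y hy
        refine ⟨contr i v, mem_iUnion.2 ⟨i, v, hv, rfl⟩, ?_⟩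
        rw [dist_contr, pow_succ]
        linarith
    intro x hx
    rw [gasket, Metric.mem_closure_iff]
    intro ε hε
    have ht : Tendsto (fun n : ℕ => (1 / 2 : ℝ) ^ n * R) atTop (𝓝 (0 * R)) :=
      (tendsto_pow_atTop_nhds_zero_of_lt_one (by norm_num) (by norm_num)).mul_const R
    rw [zero_mul] at ht
    obtain ⟨n, hn⟩ := (ht.eventually (gt_mem_nhds hε)).exists
    obtain ⟨v, hv, hd⟩ := key n x hx
    exact ⟨v, mem_iUnion.2 ⟨n, hv⟩, hd.trans_lt hn⟩
  · refine closure_minimal (iUnion_subset fun n => ?_) hK.isClosed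
    induction n with
    | zero =>
      rintro _ ⟨i, rfl⟩
      obtain ⟨x, hx⟩ := hne
      have hit : ∀ n : ℕ, (contr i)^[n] x ∈ K := by
        intro n
        induction n with
        | zero => exact hx
        | succ n ih => rw [Function.iterate_succ_apply']; exact hmap i _ ih
      refine hK.isClosed.mem_of_tendsto (f := fun n : ℕ => (contr i)^[n] x) (b := atTop) ?_
        (Eventually.of_forall hit)
      rw [tendsto_iff_dist_tendsto_zero]
      have hd : ∀ n : ℕ, dist ((contr i)^[n] x) (corner i) = (1 / 2) ^ n * dist x (corner i) := by
        intro n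
        rw [← dist_iterate_contr, Function.iterate_fixed (contr_corner i)]
      simp only [hd]
      have ht := (tendsto_pow_atTop_nhds_zero_of_lt_one (r := (1 / 2 : ℝ)) (by norm_num)
        (by norm_num)).mul_const (dist x (corner i))
      rwa [zero_mul] at ht
    | succ n ih =>
      refine iUnion_subset fun i => ?_
      rintro _ ⟨x, hx, rfl⟩
      exact hmap i x (ih hx)

/-! The energies of level `n` increase with `n`, so that their limit exists in `[0, ∞]`. -/

lemma discreteEnergy_succ (n : ℕ) (u : Plane → ℝ) :
    discreteEnergy (n + 1) u = 5 / 3 * ∑ i, discreteEnergy n (u ∘ contr i) := by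
  unfold discreteEnergy
  rw [← Equiv.sum_comp (Fin.consEquiv fun _ : Fin (n + 1) => Fin 3), Fintype.sum_prod_type,
    ← Finset.mul_sum, pow_succ]
  simp [Fin.consEquiv, List.ofFn_succ, wordMap]
  ring

lemma discreteEnergy_zero_le (u : Plane → ℝ) : discreteEnergy 0 u ≤ discreteEnergy 1 u := by
  rw [discreteEnergy_succ]
  simp only [discreteEnergy, Fin.sum_univ_three, Finset.univ_unique, Finset.sum_singleton,
    List.ofFn_zero, wordMap, Function.comp_apply, id, contr_corner, contr_corner_comm 1 0,
    contr_corner_comm 2 0, contr_corner_comm 2 1, pow_zero, one_mul]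
  generalize u (corner 0) = a
  generalize u (corner 1) = b
  generalize u (corner 2) = c
  generalize u (contr 0 (corner 1)) = x
  generalize u (contr 0 (corner 2)) = y
  generalize u (contr 1 (corner 2)) = z
  nlinarith [sq_nonneg (5 * x - (2 * a + 2 * b + c)), sq_nonneg (5 * y - (2 * a + b + 2 * c)),
    sq_nonneg (5 * z - (a + 2 * b + 2 * c)),
    sq_nonneg ((5 * x - (2 * a + 2 * b + c)) - (5 * y - (2 * a + b + 2 * c))),
    sq_nonneg ((5 * x - (2 * a + 2 * b + c)) - (5 * z - (a + 2 * b + 2 * c))),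
    sq_nonneg ((5 * y - (2 * a + b + 2 * c)) - (5 * z - (a + 2 * b + 2 * c)))]

lemma discreteEnergy_mono (u : Plane → ℝ) : Monotone fun n => discreteEnergy n u := by
  refine monotone_nat_of_le_succ fun n => ?_
  induction n generalizing u with
  | zero => exact discreteEnergy_zero_le u
  | succ n ih =>
    rw [discreteEnergy_succ, discreteEnergy_succ (n + 1)]
    have := Finset.sum_le_sum fun (i : Fin 3) (_ : i ∈ Finset.univ) => ih (u ∘ contr i)
    linarith

theorem tendsto_localEnergy (u : Plane → ℝ) :
    Tendsto (fun n : ℕ => ENNReal.ofReal (discreteEnergy n u)) atTop (𝓝 (localEnergy u)) :=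
  tendsto_nhds_limUnder
    ⟨_, tendsto_atTop_iSup fun _ _ h => ENNReal.ofReal_le_ofReal (discreteEnergy_mono u h)⟩

end SierpinskiGasket

end

open scoped Pointwise

noncomputable section

namespace SierpinskiGasket

/-! ### Words, cells and barycentric coordinates -/

/-! Put `x_i = 2 ^ β i / 5`, so that `x_i < 1` and `x_i → 1`, and let `D_n` be the discrete energy
of level `n`. If `x` and `y` lie in the small cells at two distinct vertices `p`, `q` of the same
`K_w` with `|w| = n`, then `|x - y|` equals `2⁻ⁿ` up to a relative error `2 · 2⁻ⁱ`, and `u(x) -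
u(y)` is close to `u(p) - u(q)`. Because `2^α = 3`, the factor `2^(-2αn) · 2^((α+β)n)` is `x_i^n
(5/3)^n`, so the level `n` part of `C_i` has energy about `x_i^n D_n` (`levelEnergy_bounds`).

After multiplication by `1 - x_i` this is a truncated Abelian mean of the increasing sequence `D_n`.
The condition on `Φ` makes the lost tail at most `e⁻ⁱ`, so the means tend to `lim D_n`, the local
energy (`tendsto_sum_one_sub_mul_pow_mul`).

The summand `1 - δ_i` must contribute nothing in the limit. For this, `1 - x_i` times the energy
with coefficient `1` is bounded by a constant multiple of the local energy, uniformly in `i`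
(`lintegral_div_dist_rpow_le`). The bound follows from a dyadic decomposition in `|x - y|` and from
`nearEnergy_le`: pairs at distance below `2⁻⁽ⁿ⁺¹⁾` carry at most `400 · 15⁻ⁿ` times the local
energy. Since `2^(α+β) = 15 x_i`, the scales add up to a geometric series in `x_i`, whose sum `1 /
(1 - x_i)` is cancelled by the prefactor.

Both halves rest on the self-similarity of the local energy, on the oscillation bound
`abs_sub_corner_le`, and on `ν(K_w) = 3^(-|w|)`. The last one requires that the Hausdorff measure of
the gasket is finite (covering by cells) and positive (mass distribution principle for the law of a
random coded point). -/

lemma wordMap_append (v w : List (Fin 3)) : wordMap (v ++ w) = wordMap v ∘ wordMap w := by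
  induction v with
  | nil => rfl
  | cons i v ih => simp [wordMap, ih, Function.comp_assoc]

lemma continuous_wordMap (w : List (Fin 3)) : Continuous (wordMap w) := by
  induction w with
  | nil => exact continuous_id
  | cons i w ih => exact (continuous_contr i).comp ih

lemma dist_wordMap (w : List (Fin 3)) (x y : Plane) :
    dist (wordMap w x) (wordMap w y) = (1 / 2) ^ w.length * dist x y := by
  induction w with
  | nil => simp [wordMap]
  | cons i w ih => simp only [wordMap, Function.comp_apply, dist_contr, ih, List.length_cons]; ring

lemma contr_mem_gasket (i : Fin 3) {x : Plane} (hx : x ∈ gasket) : contr i x ∈ gasket := by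
  rw [gasket_selfSimilar]; exact mem_iUnion.2 ⟨i, x, hx, rfl⟩

lemma exists_contr_eq {x : Plane} (hx : x ∈ gasket) : ∃ i, ∃ y ∈ gasket, contr i y = x := by
  rw [gasket_selfSimilar] at hx; exact mem_iUnion.1 hx

lemma corner_mem_gasket (i : Fin 3) : corner i ∈ gasket :=
  subset_closure (mem_iUnion.2 ⟨0, i, rfl⟩)

lemma wordMap_mem_gasket (w : List (Fin 3)) {x : Plane} (hx : x ∈ gasket) :
    wordMap w x ∈ gasket := by
  induction w with
  | nil => exact hx
  | cons i w ih => exact contr_mem_gasket i ih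

lemma wordMap_replicate_corner (n : ℕ) (j : Fin 3) :
    wordMap (List.replicate n j) (corner j) = corner j := by
  induction n with
  | zero => rfl
  | succ n ih => simp [List.replicate_succ, wordMap, ih, contr_corner]

lemma isCompact_cell (w : List (Fin 3)) : IsCompact (cell w) :=
  gasket_isCompact.image (continuous_wordMap w)

lemma measurableSet_cell (w : List (Fin 3)) : MeasurableSet (cell w) :=
  (isCompact_cell w).isClosed.measurableSet

lemma cell_subset_gasket (w : List (Fin 3)) : cell w ⊆ gasket := by
  rintro _ ⟨x, hx, rfl⟩; exact wordMap_mem_gasket w hx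

lemma gasket_induction {p : Plane → Prop} (hp : IsClosed {x | p x}) (h0 : ∀ i, p (corner i))
    (h1 : ∀ i x, p x → p (contr i x)) {x : Plane} (hx : x ∈ gasket) : p x := by
  refine closure_minimal (iUnion_subset fun n => ?_) hp hx
  induction n with
  | zero => rintro _ ⟨i, rfl⟩; exact h0 i
  | succ n ih =>
    refine iUnion_subset fun i => ?_
    rintro _ ⟨y, hy, rfl⟩
    exact h1 i y (ih hy)

lemma dist_corner_corner {i j : Fin 3} (hij : i ≠ j) : dist (corner i) (corner j) = 1 := by
  have h3 := Real.sq_sqrt (show (0 : ℝ) ≤ 3 by norm_num)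
  rw [EuclideanSpace.dist_eq, Real.sqrt_eq_one, Fin.sum_univ_two, Real.dist_eq, Real.dist_eq,
    sq_abs, sq_abs]
  fin_cases i <;> fin_cases j <;> first | exact absurd rfl hij | (simp [corner]; try nlinarith)

/-- The bound `1` is preserved by `contr i`, because the distance of `contr i x` to `p_j` is at most
the average of the distances of `x` and `p_i` to `p_j`. -/
lemma dist_corner_le {x : Plane} (hx : x ∈ gasket) (j : Fin 3) : dist x (corner j) ≤ 1 := by
  have key : ∀ i, dist (corner i) (corner j) ≤ 1 := fun i => by
    rcases eq_or_ne i j with rfl | h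
    · simp
    · exact (dist_corner_corner h).le
  refine gasket_induction (p := fun x => dist x (corner j) ≤ 1)
    (isClosed_le (by fun_prop) continuous_const) key (fun i x hx => ?_) hx
  have h1 := dist_triangle (contr i x) (contr i (corner j)) (corner j)
  have h2 : dist (contr i (corner j)) (corner j) = 1 / 2 * dist (corner i) (corner j) := by
    rw [contr_corner_comm, ← dist_contr j, contr_corner]
  rw [dist_contr, h2] at h1
  linarith [key i]

/-- The barycentric coordinates with respect to the corners. -/
def bary (j : Fin 3) (x : Plane) : ℝ :=
  (![1 - x 0 - x 1 / √3, x 0 - x 1 / √3, 2 * (x 1 / √3)] : Fin 3 → ℝ) j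

lemma continuous_bary (j : Fin 3) : Continuous (bary j) := by
  unfold bary; fin_cases j <;> simp <;> fun_prop

lemma bary_corner (i j : Fin 3) : bary j (corner i) = if i = j then 1 else 0 := by
  have : √3 ≠ 0 := by positivity
  fin_cases i <;> fin_cases j <;> simp [bary, corner] <;> field_simp <;> norm_num

lemma bary_contr (i j : Fin 3) (x : Plane) :
    bary j (contr i x) = (bary j x + if i = j then 1 else 0) / 2 := by
  rw [← bary_corner, contr]
  generalize corner i = y
  fin_cases j <;> simp [bary] <;> ring

lemma bary_sub_le (j : Fin 3) (x y : Plane) : |bary j x - bary j y| ≤ 2 * dist x y := by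
  have h3 : 1 ≤ √3 := by rw [Real.one_le_sqrt]; norm_num
  have h : ∀ k : Fin 2, |x k - y k| ≤ dist x y := fun k => by
    have := PiLp.norm_apply_le (x - y) k
    rwa [← dist_eq_norm] at this
  have h0 := abs_le.1 (h 0)
  have h1 : |x 1 / √3 - y 1 / √3| ≤ dist x y := by
    rw [← sub_div, abs_div, abs_of_pos (by positivity : 0 < √3)]
    exact (div_le_self (abs_nonneg _) h3).trans (h 1)
  have h1 := abs_le.1 h1
  have := dist_nonneg (x := x) (y := y)
  rw [abs_le]
  fin_cases j <;> simp [bary] <;> constructor <;> linarith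

lemma bary_mem_Icc (j : Fin 3) {x : Plane} (hx : x ∈ gasket) : bary j x ∈ Icc (0 : ℝ) 1 := by
  refine gasket_induction (p := fun x => bary j x ∈ Icc (0 : ℝ) 1)
    (isClosed_Icc.preimage (continuous_bary j)) (fun i => ?_) (fun i x hx => ?_) hx
  · rw [bary_corner]; split_ifs <;> simp
  · rw [bary_contr]; obtain ⟨h1, h2⟩ := hx; constructor <;> split_ifs <;> linarith

/-- The `j`-th coordinate is at least `1/2` on `K_j`, half of `bary j x` at `contr i x`, and
`2`-Lipschitz. So a point of `K_i` close to `K_j` comes from a point `x` close to the corner `p_j`.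
-/
lemma lt_bary_of_dist_contr_lt {i j : Fin 3} (hij : i ≠ j) {x y : Plane} (hy : y ∈ gasket) {n : ℕ}
    (h : dist (contr i x) (contr j y) < (1 / 2) ^ (n + 2)) : 1 - (1 / 2) ^ n < bary j x := by
  have h1 := (abs_le.1 (bary_sub_le j (contr i x) (contr j y))).1
  rw [bary_contr, bary_contr, if_neg hij, if_pos rfl] at h1
  have h2 := (bary_mem_Icc j hy).1
  rw [pow_add] at h
  linarith

/-- Outside of `K_j` the `j`-th coordinate is at most `1/2`, so a larger value forces the first
letter to be `j`; zooming in doubles the distance of the coordinate to `1`. -/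
lemma mem_cell_replicate_of_lt_bary {j : Fin 3} {n : ℕ} {x : Plane} (hx : x ∈ gasket)
    (h : 1 - (1 / 2) ^ n < bary j x) : x ∈ cell (List.replicate n j) := by
  induction n generalizing x with
  | zero => exact ⟨x, hx, rfl⟩
  | succ n ih =>
    obtain ⟨i, y, hy, rfl⟩ := exists_contr_eq hx
    have hp : (1 / 2 : ℝ) ^ n ≤ 1 := pow_le_one₀ (by norm_num) (by norm_num)
    have hb := (bary_mem_Icc j hy).2
    rw [bary_contr, pow_succ] at h
    split_ifs at h with hij
    · subst hij
      obtain ⟨z, hz, rfl⟩ := ih hy (by linarith)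
      exact ⟨z, hz, by simp [List.replicate_succ, wordMap]⟩
    · linarith

/-! ### Self-similarity of the local energy and the oscillation estimate -/

lemma ofReal_discreteEnergy_le (n : ℕ) (u : Plane → ℝ) :
    ENNReal.ofReal (discreteEnergy n u) ≤ localEnergy u :=
  Monotone.ge_of_tendsto (f := fun n : ℕ => ENNReal.ofReal (discreteEnergy n u))
    (fun _ _ h => ENNReal.ofReal_le_ofReal (discreteEnergy_mono u h)) (tendsto_localEnergy u) n

lemma discreteEnergy_nonneg (n : ℕ) (u : Plane → ℝ) : 0 ≤ discreteEnergy n u := by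
  unfold discreteEnergy; positivity

lemma ofReal_three_div_five : ENNReal.ofReal (3 / 5) = 3 / 5 := by
  rw [ENNReal.ofReal_div_of_pos (by norm_num)]; norm_num

/-- The limit of `discreteEnergy_succ`. It is the source of every factor `3/5` below. -/
lemma sum_localEnergy_contr (u : Plane → ℝ) :
    ∑ i, localEnergy (u ∘ contr i) = 3 / 5 * localEnergy u := by
  have h1 : Tendsto (fun n => ∑ i, ENNReal.ofReal (discreteEnergy n (u ∘ contr i))) atTop
      (𝓝 (∑ i, localEnergy (u ∘ contr i))) :=
    tendsto_finsetSum _ fun i _ => tendsto_localEnergy (u ∘ contr i)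
  have h2 : Tendsto (fun n : ℕ => 3 / 5 * ENNReal.ofReal (discreteEnergy (n + 1) u)) atTop
      (𝓝 (3 / 5 * localEnergy u)) := by
    refine ENNReal.Tendsto.const_mul ((tendsto_add_atTop_iff_nat 1).2 (tendsto_localEnergy u))
      (Or.inr ?_)
    rw [← ofReal_three_div_five]; exact ENNReal.ofReal_ne_top
  refine tendsto_nhds_unique h1 (h2.congr fun n => ?_)
  rw [← ENNReal.ofReal_sum_of_nonneg fun i _ => discreteEnergy_nonneg n _, ← ofReal_three_div_five,
    ← ENNReal.ofReal_mul (by norm_num), discreteEnergy_succ]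
  congr 1; ring

lemma sum_localEnergy_wordMap (n : ℕ) (u : Plane → ℝ) :
    ∑ w : Fin n → Fin 3, localEnergy (u ∘ wordMap (List.ofFn w)) = (3 / 5) ^ n * localEnergy u := by
  induction n generalizing u with
  | zero => simp [wordMap]
  | succ n ih =>
    rw [← Equiv.sum_comp (Fin.consEquiv fun _ : Fin (n + 1) => Fin 3), Fintype.sum_prod_type]
    have : ∀ i : Fin 3, ∑ w : Fin n → Fin 3, localEnergy (u ∘ wordMap (List.ofFn
        ((Fin.consEquiv fun _ : Fin (n + 1) => Fin 3) (i, w)))) =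
        (3 / 5) ^ n * localEnergy (u ∘ contr i) := fun i => by
      rw [← ih (u ∘ contr i)]
      refine Finset.sum_congr rfl fun w _ => ?_
      simp [Fin.consEquiv, List.ofFn_succ, wordMap, Function.comp_assoc]
    rw [Finset.sum_congr rfl fun i _ => this i, ← Finset.mul_sum, sum_localEnergy_contr, pow_succ,
      mul_assoc]

lemma localEnergy_contr_le (i : Fin 3) (u : Plane → ℝ) :
    localEnergy (u ∘ contr i) ≤ 3 / 5 * localEnergy u := by
  rw [← sum_localEnergy_contr]
  exact Finset.single_le_sum (f := fun i => localEnergy (u ∘ contr i)) (fun _ _ => zero_le)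
    (Finset.mem_univ i)

lemma localEnergy_wordMap_le (w : List (Fin 3)) (u : Plane → ℝ) :
    localEnergy (u ∘ wordMap w) ≤ (3 / 5) ^ w.length * localEnergy u := by
  induction w generalizing u with
  | nil => simp [wordMap]
  | cons i w ih =>
    have := (ih (u ∘ contr i)).trans (mul_le_mul_right (localEnergy_contr_le i u) _)
    rwa [← mul_assoc, ← pow_succ] at this

/-- Chaining through corners: passing to a subcell multiplies the energy by at most `3/5`, hence its
root by at most `4/5`, and costs one jump between corners, at most `√M`. The constant `5` solves `c
= 1 + (4/5) c`. This treats all vertices, and continuity extends the bound to their closure. -/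
lemma abs_sub_corner_le {u : Plane → ℝ} (hu : ContinuousOn u gasket) {M : ℝ}
    (hM : ∀ n, discreteEnergy n u ≤ M) {x : Plane} (hx : x ∈ gasket) (j : Fin 3) :
    |u x - u (corner j)| ≤ 5 * √M := by
  have vert : ∀ n (u : Plane → ℝ) (M : ℝ), (∀ n, discreteEnergy n u ≤ M) → ∀ x ∈ vertexSet n,
      ∀ j, |u x - u (corner j)| ≤ 5 * √M := by
    intro n
    have corners : ∀ (u : Plane → ℝ) (M : ℝ), (∀ n, discreteEnergy n u ≤ M) → ∀ i j,
        |u (corner i) - u (corner j)| ≤ √M := fun u M hM i j => by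
      refine Real.abs_le_sqrt (le_trans ?_ (hM 0))
      simp only [discreteEnergy, pow_zero, one_mul, Finset.univ_unique, Finset.sum_singleton,
        List.ofFn_zero, wordMap, id]
      refine le_trans ?_ (Finset.single_le_sum (f := fun i => ∑ k : Fin 3,
        (u (corner i) - u (corner k)) ^ 2) (fun i _ => by positivity) (Finset.mem_univ i))
      exact Finset.single_le_sum (f := fun k => (u (corner i) - u (corner k)) ^ 2)
        (fun i _ => by positivity) (Finset.mem_univ j)
    induction n with
    | zero =>
      rintro u M hM _ ⟨i, rfl⟩ j
      linarith [corners u M hM i j, Real.sqrt_nonneg M]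
    | succ n ih =>
      intro u M hM x hx j
      obtain ⟨i, y, hy, rfl⟩ := mem_iUnion.1 hx
      have h1 := ih (u ∘ contr i) (3 / 5 * M) (fun k => ?_) y hy i
      · have h2 := corners u M hM i j
        -- The rational bound `4/5` replaces `√(3/5)`, because `3/5 ≤ 16/25`.
        have h3 : √(3 / 5 * M) ≤ 4 / 5 * √M := by
          rw [show (4 / 5 : ℝ) = √(16 / 25) by
            rw [eq_comm, Real.sqrt_eq_iff_mul_self_eq] <;> norm_num, ← Real.sqrt_mul (by norm_num)]
          have := (discreteEnergy_nonneg 0 u).trans (hM 0)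
          exact Real.sqrt_le_sqrt (by linarith)
        simp only [Function.comp_apply, contr_corner] at h1
        have h4 := abs_sub_le (u (contr i y)) (u (corner i)) (u (corner j))
        linarith
      · have h1 := hM (k + 1)
        rw [discreteEnergy_succ] at h1
        have h2 := Finset.single_le_sum (f := fun i => discreteEnergy k (u ∘ contr i))
          (fun i _ => discreteEnergy_nonneg k _) (Finset.mem_univ i)
        linarith
  have hcl : gasket ⊆ closure (⋃ n, vertexSet n) := subset_rfl
  have hsub : (⋃ n, vertexSet n) ⊆ gasket := subset_closure
  have hmaps : MapsTo (fun x => |u x - u (corner j)|) (⋃ n, vertexSet n) (Iic (5 * √M)) :=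
    fun y hy => by
      obtain ⟨n, hn⟩ := mem_iUnion.1 hy
      exact vert n u M hM y hn j
  have hc : ContinuousOn (fun x => |u x - u (corner j)|) gasket :=
    (hu.sub continuousOn_const).abs
  have := hmaps.closure_of_continuousOn hc (hcl hx)
  rwa [isClosed_Iic.closure_eq] at this

lemma ofReal_sq_sub_corner_le {u : Plane → ℝ} (hu : ContinuousOn u gasket) {x : Plane}
    (hx : x ∈ gasket) (j : Fin 3) :
    ENNReal.ofReal ((u x - u (corner j)) ^ 2) ≤ 25 * localEnergy u := by
  rcases eq_or_ne (localEnergy u) ∞ with h | h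
  · simp [h]
  have hM : ∀ n, discreteEnergy n u ≤ (localEnergy u).toReal := fun n =>
    (ENNReal.ofReal_le_iff_le_toReal h).1 (ofReal_discreteEnergy_le n u)
  rw [ENNReal.ofReal_le_iff_le_toReal (ENNReal.mul_ne_top (by simp) h), ENNReal.toReal_mul, ← sq_abs]
  calc _ ≤ (5 * √(localEnergy u).toReal) ^ 2 :=
        pow_le_pow_left₀ (abs_nonneg _) (abs_sub_corner_le hu hM hx j) 2
    _ = _ := by rw [mul_pow, Real.sq_sqrt ENNReal.toReal_nonneg]; norm_num

lemma ofReal_sq_sub_le_add (a b c : ℝ) : ENNReal.ofReal ((a - b) ^ 2) ≤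
    2 * ENNReal.ofReal ((a - c) ^ 2) + 2 * ENNReal.ofReal ((b - c) ^ 2) := by
  rw [show (2 : ℝ≥0∞) = ENNReal.ofReal 2 by simp, ← ENNReal.ofReal_mul (by norm_num),
    ← ENNReal.ofReal_mul (by norm_num), ← ENNReal.ofReal_add (by positivity) (by positivity)]
  exact ENNReal.ofReal_le_ofReal (by nlinarith [sq_nonneg (a - c + (b - c))])

lemma ofReal_sq_sub_le {u : Plane → ℝ} (hu : ContinuousOn u gasket) {x y : Plane}
    (hx : x ∈ gasket) (hy : y ∈ gasket) :
    ENNReal.ofReal ((u x - u y) ^ 2) ≤ 100 * localEnergy u := by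
  refine (ofReal_sq_sub_le_add _ _ (u (corner 0))).trans ?_
  refine (add_le_add (mul_le_mul_right (ofReal_sq_sub_corner_le hu hx 0) 2)
    (mul_le_mul_right (ofReal_sq_sub_corner_le hu hy 0) 2)).trans_eq ?_
  ring

/-! ### The Hausdorff measure of the gasket is positive and finite -/

lemma hdim_pos : 0 < hdim := div_pos (Real.log_pos (by norm_num)) (Real.log_pos (by norm_num))

lemma two_rpow_hdim : (2 : ℝ) ^ hdim = 3 := by
  rw [hdim, Real.log_div_log, Real.rpow_logb] <;> norm_num

lemma ennreal_half_rpow_hdim : (2⁻¹ : ℝ≥0∞) ^ hdim = 3⁻¹ := by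
  rw [ENNReal.inv_rpow, show (2 : ℝ≥0∞) = ENNReal.ofReal 2 by simp,
    ENNReal.ofReal_rpow_of_pos (by norm_num), two_rpow_hdim]
  simp

lemma hausdorffMeasure_contr_image (i : Fin 3) (s : Set Plane) :
    μH[hdim] (contr i '' s) = 3⁻¹ * μH[hdim] s := by
  have h : contr i '' s = (2⁻¹ : ℝ) • ((IsometryEquiv.addRight (corner i)) '' s) := by
    rw [← image_smul, image_image]
    exact image_congr fun x _ => by simp [contr]
  rw [h, Measure.hausdorffMeasure_smul₀ hdim_pos.le (by norm_num),
    IsometryEquiv.hausdorffMeasure_image, ← ennreal_half_rpow_hdim, ENNReal.smul_def, smul_eq_mul,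
    ENNReal.coe_rpow_of_nonneg _ hdim_pos.le]
  congr 2
  rw [nnnorm_inv, ENNReal.coe_inv (by simp)]
  simp

lemma hausdorffMeasure_cell (w : List (Fin 3)) :
    μH[hdim] (cell w) = 3⁻¹ ^ w.length * μH[hdim] gasket := by
  induction w with
  | nil => simp [cell, wordMap]
  | cons i w ih =>
    rw [cell, wordMap, image_comp, hausdorffMeasure_contr_image, ← cell, ih, List.length_cons,
      pow_succ', mul_assoc]

lemma gasket_subset_iUnion_cell (n : ℕ) : gasket ⊆ ⋃ w : Fin n → Fin 3, cell (List.ofFn w) := by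
  induction n with
  | zero => intro x hx; exact mem_iUnion.2 ⟨Fin.elim0, x, hx, rfl⟩
  | succ n ih =>
    intro x hx
    obtain ⟨i, y, hy, rfl⟩ := exists_contr_eq hx
    obtain ⟨w, z, hz, rfl⟩ := mem_iUnion.1 (ih hy)
    exact mem_iUnion.2 ⟨Fin.cons i w, z, hz, by simp [List.ofFn_succ, wordMap]⟩

lemma ediam_cell_le (w : List (Fin 3)) : Metric.ediam (cell w) ≤ 2 * 2⁻¹ ^ w.length := by
  refine Metric.ediam_le ?_
  rintro _ ⟨x, hx, rfl⟩ _ ⟨y, hy, rfl⟩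
  have h : dist x y ≤ 2 := by
    linarith [dist_triangle_right x y (corner 0), dist_corner_le hx 0, dist_corner_le hy 0]
  have h2 : (2 : ℝ≥0∞) * 2⁻¹ ^ w.length = ENNReal.ofReal ((1 / 2) ^ w.length * 2) := by
    rw [ENNReal.ofReal_mul (by positivity), ENNReal.ofReal_pow (by norm_num), one_div,
      ENNReal.ofReal_inv_of_pos (by norm_num), mul_comm]
    simp
  rw [edist_dist, dist_wordMap, h2]
  exact ENNReal.ofReal_le_ofReal (by gcongr)

/-- The `3ⁿ` cells of level `n` have diameter at most `2 · 2⁻ⁿ`, and `2^α = 3`, so their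
`α`-dimensional sums never exceed `2^α`. -/
lemma hausdorffMeasure_gasket_ne_top : μH[hdim] gasket ≠ ∞ := by
  have h2 : (2⁻¹ : ℝ≥0∞) < 1 := by simp
  have hr : Tendsto (fun n : ℕ => (2 : ℝ≥0∞) * 2⁻¹ ^ n) atTop (𝓝 0) := by
    have := ENNReal.Tendsto.const_mul (a := 2) (ENNReal.tendsto_pow_atTop_nhds_zero_of_lt_one h2)
      (Or.inr (by simp))
    simpa using this
  have key := Measure.hausdorffMeasure_le_liminf_sum hdim gasket (l := atTop) _ hr
    (fun n (w : Fin n → Fin 3) => cell (List.ofFn w))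
    (Eventually.of_forall fun n w => by simpa using ediam_cell_le (List.ofFn w))
    (Eventually.of_forall gasket_subset_iUnion_cell)
  refine (key.trans_lt (lt_of_le_of_lt (b := 2 ^ hdim) ?_ ?_)).ne
  · refine (liminf_le_liminf (v := fun _ => (2 : ℝ≥0∞) ^ hdim) (Eventually.of_forall fun n => ?_)).trans
      (by simp)
    have : ∀ w : Fin n → Fin 3, Metric.ediam (cell (List.ofFn w)) ^ hdim ≤
        2 ^ hdim * 3⁻¹ ^ n := fun w => by
      refine (ENNReal.rpow_le_rpow (ediam_cell_le _) hdim_pos.le).trans_eq ?_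
      rw [ENNReal.mul_rpow_of_nonneg _ _ hdim_pos.le, List.length_ofFn,
        ← ENNReal.rpow_natCast, ← ENNReal.rpow_mul, mul_comm (n : ℝ), ENNReal.rpow_mul,
        ennreal_half_rpow_hdim, ENNReal.rpow_natCast]
    refine (Finset.sum_le_sum fun w _ => this w).trans_eq ?_
    rw [Finset.sum_const, Finset.card_univ, nsmul_eq_mul, mul_left_comm]
    simp only [Fintype.card_fun, Fintype.card_fin, Nat.cast_pow, Nat.cast_ofNat]
    rw [← mul_pow, ENNReal.mul_inv_cancel (by simp) (by simp), one_pow, mul_one]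
  · exact ENNReal.rpow_lt_top_of_nonneg hdim_pos.le (by simp)

/-- The uniform distribution on the three letters. -/
def letterMeasure : Measure (Fin 3) := (3⁻¹ : ℝ≥0∞) • Measure.count

instance : IsProbabilityMeasure letterMeasure :=
  ⟨by simp [letterMeasure, ENNReal.inv_mul_cancel]⟩

/-- The law of an infinite word with independent uniformly distributed letters. -/
def wordMeasure : Measure (ℕ → Fin 3) := Measure.infinitePi fun _ => letterMeasure

instance : IsProbabilityMeasure wordMeasure := by unfold wordMeasure; infer_instance

/-- The infinite word with first letter `i` followed by `ω`. -/
def consWord (i : Fin 3) (ω : ℕ → Fin 3) : ℕ → Fin 3 := fun n => Nat.casesOn n i ω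

lemma measurable_consWord (i : Fin 3) : Measurable (consWord i) := by
  refine measurable_pi_lambda _ fun n => ?_
  cases n with
  | zero => exact measurable_const
  | succ n => exact measurable_pi_apply n

/-- Conditioning on the first letter. By uniqueness of the product measure it is enough to compare
both sides on cylinder sets. -/
lemma wordMeasure_eq_sum : wordMeasure = ∑ i, (3⁻¹ : ℝ≥0∞) • wordMeasure.map (consWord i) := by
  refine (Measure.eq_infinitePi _ fun s t ht => ?_).symm
  classical
  obtain ⟨n, hn⟩ := s.exists_nat_subset_range
  have hn' : s ⊆ Finset.range (n + 1) := hn.trans (Finset.range_subset_range.2 n.le_succ)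
  -- Unconstrained coordinates are filled with `univ`, so that the cylinder lives on an initial
  -- segment and its coordinate `0` can be split off.
  let t' : ℕ → Set (Fin 3) := fun k => if k ∈ s then t k else univ
  have h1 : Set.pi (s : Set ℕ) t = Set.pi (Finset.range (n + 1)) t' := by
    ext ω
    simp only [Set.mem_pi, Finset.mem_coe, t']
    refine ⟨fun h k _ => ?_, fun h k hk => ?_⟩
    · split_ifs with hk
      · exact h k hk
      · trivial
    · simpa [hk] using h k (hn' hk)
  have h2 : ∏ i ∈ s, letterMeasure (t i) = ∏ i ∈ Finset.range (n + 1), letterMeasure (t' i) := by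
    rw [← Finset.prod_subset hn' fun k _ hk => by simp [t', hk]]
    exact Finset.prod_congr rfl fun k hk => by simp [t', hk]
  have h3 : ∀ i, consWord i ⁻¹' Set.pi (Finset.range (n + 1)) t' =
      if i ∈ t' 0 then Set.pi (Finset.range n) (fun k => t' (k + 1)) else ∅ := fun i => by
    ext ω
    split_ifs with hi
    · simp only [mem_preimage, Set.mem_pi, Finset.coe_range, mem_Iio]
      refine ⟨fun h k hk => h (k + 1) (by omega), fun h k hk => ?_⟩
      cases k with
      | zero => exact hi
      | succ k => exact h k (by omega)
    · simp only [mem_preimage, Set.mem_pi, Finset.coe_range, mem_Iio, mem_empty_iff_false, iff_false]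
      exact fun h => hi (h 0 (by omega))
  have hmeas : MeasurableSet (Set.pi (Finset.range (n + 1) : Set ℕ) t') :=
    MeasurableSet.pi (Finset.countable_toSet _) fun _ _ => MeasurableSet.of_discrete
  rw [h1, h2, Finset.prod_range_succ']
  simp only [Measure.coe_finsetSum, Finset.sum_apply, Measure.smul_apply, smul_eq_mul]
  have h4 : ∀ i, (wordMeasure.map (consWord i)) (Set.pi (Finset.range (n + 1)) t') =
      (∏ k ∈ Finset.range n, letterMeasure (t' (k + 1))) * (t' 0).indicator 1 i := fun i => by
    rw [Measure.map_apply (measurable_consWord i) hmeas, h3]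
    by_cases hi : i ∈ t' 0
    · rw [if_pos hi, indicator_of_mem hi, wordMeasure, Measure.infinitePi_pi _
        fun _ _ => MeasurableSet.of_discrete]
      simp
    · simp [hi]
  simp only [h4]
  rw [← Finset.mul_sum, ← Finset.mul_sum, mul_left_comm]
  congr 1
  rw [letterMeasure, Measure.smul_apply, smul_eq_mul,
    ← lintegral_indicator_one MeasurableSet.of_discrete, lintegral_count, tsum_fintype]

/-- The point of the gasket coded by an infinite word. -/
def codingMap (ω : ℕ → Fin 3) : Plane := ∑' n, (1 / 2 : ℝ) ^ (n + 1) • corner (ω n)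

lemma norm_codingMap_term_le (ω : ℕ → Fin 3) (n : ℕ) :
    ‖(1 / 2 : ℝ) ^ (n + 1) • corner (ω n)‖ ≤ (1 / 2) ^ n := by
  rw [norm_smul, norm_pow, Real.norm_of_nonneg (by norm_num : (0 : ℝ) ≤ 1 / 2)]
  have h1 := norm_corner_le (ω n)
  have h2 : (1 / 2 : ℝ) ^ (n + 1) ≤ (1 / 2) ^ n :=
    pow_le_pow_of_le_one (by norm_num) (by norm_num) n.le_succ
  exact (mul_le_of_le_one_right (by positivity) h1).trans h2

lemma summable_codingMap (ω : ℕ → Fin 3) :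
    Summable fun n => (1 / 2 : ℝ) ^ (n + 1) • corner (ω n) :=
  Summable.of_norm_bounded summable_geometric_two (norm_codingMap_term_le ω)

lemma measurable_codingMap : Measurable codingMap := by
  refine (continuous_tsum (fun n => ?_) summable_geometric_two
    fun n ω => norm_codingMap_term_le ω n).measurable
  have : Continuous fun ω : ℕ → Fin 3 => corner (ω n) :=
    (continuous_of_discreteTopology (f := corner)).comp (continuous_apply (A := fun _ => Fin 3) n)
  exact this.const_smul ((1 / 2 : ℝ) ^ (n + 1))

lemma codingMap_consWord (i : Fin 3) (ω : ℕ → Fin 3) :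
    codingMap (consWord i ω) = contr i (codingMap ω) := by
  rw [codingMap, (summable_codingMap _).tsum_eq_zero_add, contr, smul_add, codingMap,
    ← (summable_codingMap ω).tsum_const_smul, add_comm]
  simp only [consWord, smul_smul, pow_succ']
  simp

lemma codingMap_mem_gasket (ω : ℕ → Fin 3) : codingMap ω ∈ gasket := by
  have key : ∀ n, ∀ ω : ℕ → Fin 3,
      ∑ k ∈ Finset.range n, (1 / 2 : ℝ) ^ (k + 1) • corner (ω k) ∈ gasket := by
    intro n
    induction n with
    | zero =>
      intro ω
      -- As `p_0` is the origin, partial sums code words ending in `000…` and therefore lie in the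
      -- gasket.
      have : corner 0 = 0 := by ext k; fin_cases k <;> simp [corner]
      simpa [this] using corner_mem_gasket 0
    | succ n ih =>
      intro ω
      have := contr_mem_gasket (ω 0) (ih fun k => ω (k + 1))
      rw [contr, smul_add, Finset.smul_sum] at this
      rw [Finset.sum_range_succ']
      simpa only [smul_smul, pow_succ', pow_zero, mul_one] using this
  exact gasket_isCompact.isClosed.mem_of_tendsto (summable_codingMap ω).hasSum.tendsto_sum_nat
    (Eventually.of_forall fun n => key n ω)

/-- The law of the point coded by a random word. -/
def codedMeasure : Measure Plane := wordMeasure.map codingMap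

instance : IsProbabilityMeasure codedMeasure :=
  Measure.isProbabilityMeasure_map measurable_codingMap.aemeasurable

lemma codedMeasure_compl_gasket : codedMeasure gasketᶜ = 0 := by
  rw [codedMeasure, Measure.map_apply measurable_codingMap
    gasket_isCompact.isClosed.measurableSet.compl]
  convert measure_empty (μ := wordMeasure)
  ext ω
  simp [codingMap_mem_gasket]

lemma codedMeasure_apply {s : Set Plane} (hs : MeasurableSet s) :
    codedMeasure s = 3⁻¹ * ∑ i, codedMeasure (contr i ⁻¹' s) := by
  rw [codedMeasure, Measure.map_apply measurable_codingMap hs]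
  conv_lhs => rw [wordMeasure_eq_sum]
  simp only [Measure.coe_finsetSum, Finset.sum_apply, Measure.smul_apply, smul_eq_mul]
  rw [← Finset.mul_sum]
  congr 1
  refine Finset.sum_congr rfl fun i _ => ?_
  rw [Measure.map_apply (measurable_consWord i) (measurable_codingMap hs),
    Measure.map_apply measurable_codingMap ((continuous_contr i).measurable hs)]
  congr 1
  ext ω
  simp [codingMap_consWord]

lemma codedMeasure_mono {s t : Set Plane} (h : s ∩ gasket ⊆ t) :
    codedMeasure s ≤ codedMeasure t := by
  refine (measure_mono (t := t ∪ gasketᶜ) fun x hx => ?_).trans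
    ((measure_union_le _ _).trans_eq (by rw [codedMeasure_compl_gasket, add_zero]))
  by_cases hxg : x ∈ gasket
  · exact Or.inl (h ⟨hx, hxg⟩)
  · exact Or.inr hxg

lemma codedMeasure_le_of_preimage {s : Set Plane} (hs : MeasurableSet s) (j : Fin 3) {c : ℝ≥0∞}
    (h : ∀ i ≠ j, contr i ⁻¹' s ∩ gasket ⊆ ∅) (hc : codedMeasure (contr j ⁻¹' s) ≤ c) :
    codedMeasure s ≤ 3⁻¹ * c := by
  rw [codedMeasure_apply hs]
  gcongr
  rw [Finset.sum_eq_single j (fun i _ hi => le_antisymm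
    ((codedMeasure_mono (h i hi)).trans_eq measure_empty) zero_le) (by simp)]
  exact hc

lemma codedMeasure_lt_bary_le (j : Fin 3) (n : ℕ) :
    codedMeasure {x | 1 - (1 / 2) ^ n < bary j x} ≤ 3⁻¹ ^ n := by
  induction n with
  | zero => simpa using prob_le_one
  | succ n ih =>
    rw [pow_succ' (3⁻¹ : ℝ≥0∞)]
    refine codedMeasure_le_of_preimage (measurableSet_lt measurable_const
      (continuous_bary j).measurable) j (fun i hi => ?_) ((measure_mono fun x hx => ?_).trans ih)
    · rintro x ⟨hx, hxg⟩
      have hp : (1 / 2 : ℝ) ^ n ≤ 1 := pow_le_one₀ (by norm_num) (by norm_num)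
      simp only [mem_preimage, mem_ofPred_eq, bary_contr, if_neg hi, pow_succ] at hx
      linarith [(bary_mem_Icc j hxg).2]
    · simp only [mem_preimage, mem_ofPred_eq, bary_contr, if_true, pow_succ] at hx ⊢
      linarith

/-- If `s` meets only one cell of level one, zooming into it gains a factor `3⁻¹`. Otherwise each
piece of `s` in a cell `K_i` is close to another cell `K_j`, so it sits near the common vertex and
its preimage has mass at most `3⁻ⁿ`. -/
lemma codedMeasure_le_of_dist_lt (n : ℕ) {s : Set Plane} (hs : MeasurableSet s)
    (h : ∀ x ∈ s, ∀ y ∈ s, dist x y < (1 / 2) ^ (n + 1)) :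
    codedMeasure s ≤ 3 * 3⁻¹ ^ n := by
  induction n generalizing s with
  | zero => exact prob_le_one.trans (by norm_num)
  | succ n ih =>
    by_cases hj : ∃ j, ∀ i ≠ j, contr i ⁻¹' s ∩ gasket ⊆ ∅
    · obtain ⟨j, hj⟩ := hj
      rw [pow_succ', mul_left_comm]
      refine codedMeasure_le_of_preimage hs j hj (ih ((continuous_contr j).measurable hs) ?_)
      intro x hx y hy
      have := h _ hx _ hy
      rw [dist_contr, pow_succ] at this
      linarith
    · push Not at hj
      rw [codedMeasure_apply hs]
      have : ∀ i ∈ Finset.univ, codedMeasure (contr i ⁻¹' s) ≤ 3⁻¹ ^ n := fun i _ => by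
        obtain ⟨j, hji, hne⟩ := hj i
        obtain ⟨y, ⟨hy, hyg⟩, -⟩ := not_subset.1 hne
        refine le_trans (codedMeasure_mono ?_) (codedMeasure_lt_bary_le j n)
        rintro x ⟨hx, hxg⟩
        exact lt_bary_of_dist_contr_lt hji.symm hyg (h _ hx _ hy)
      refine (mul_le_mul_right (Finset.sum_le_sum this) _).trans_eq ?_
      rw [Finset.sum_const, Finset.card_univ, Fintype.card_fin, nsmul_eq_mul, pow_succ']
      push_cast
      rw [mul_left_comm]

lemma codedMeasure_le_ediam (s : Set Plane) :
    codedMeasure s ≤ 27 * Metric.ediam s ^ hdim := by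
  have hsc := Metric.ediam_closure s
  have hle : ∀ n : ℕ, Metric.ediam s < 2⁻¹ ^ (n + 1) → codedMeasure s ≤ 3 * 3⁻¹ ^ n := by
    intro n hn
    refine (measure_mono subset_closure).trans
      (codedMeasure_le_of_dist_lt n isClosed_closure.measurableSet fun x hx y hy => ?_)
    have h1 := (Metric.edist_le_ediam_of_mem hx hy).trans_lt (hsc.trans_lt hn)
    rw [edist_dist, show (2⁻¹ : ℝ≥0∞) = ENNReal.ofReal (1 / 2) by
      rw [one_div, ENNReal.ofReal_inv_of_pos (by norm_num)]; simp,
      ← ENNReal.ofReal_pow (by norm_num)] at h1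
    exact (ENNReal.ofReal_lt_ofReal_iff (by positivity)).1 h1
  rcases eq_or_ne (Metric.ediam s) 0 with h0 | h0
  · have ht : Tendsto (fun n : ℕ => (3 : ℝ≥0∞) * 3⁻¹ ^ n) atTop (𝓝 0) := by
      have := ENNReal.Tendsto.const_mul (a := 3) (ENNReal.tendsto_pow_atTop_nhds_zero_of_lt_one
        (r := 3⁻¹) (by simp)) (Or.inr (by simp))
      simpa using this
    refine (ge_of_tendsto' ht fun n => hle n ?_).trans zero_le
    rw [h0]; exact pos_iff_ne_zero.2 (by simp)
  -- With the least such `n`, either `n = 0` or the diameter is below `2⁻⁽ⁿ⁺¹⁾`, so the mass is at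
  -- most `3 · 3⁻ⁿ = 27 · 3⁻⁽ⁿ⁺²⁾`. This is where `27` comes from.
  · have hex : ∃ n : ℕ, 2⁻¹ ^ (n + 2) ≤ Metric.ediam s := by
      have ht := (ENNReal.tendsto_pow_atTop_nhds_zero_of_lt_one (r := 2⁻¹) (by simp))
      have := ((tendsto_add_atTop_iff_nat 2).2 ht).eventually (gt_mem_nhds (pos_iff_ne_zero.2 h0))
      obtain ⟨n, hn⟩ := this.exists
      exact ⟨n, hn.le⟩
    classical
    have hspec := Nat.find_spec hex
    set n := Nat.find hex with hn
    have hpow : (2⁻¹ : ℝ≥0∞) ^ (n + 2) ≤ Metric.ediam s := hspec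
    have h3 : (3⁻¹ : ℝ≥0∞) ^ (n + 2) ≤ Metric.ediam s ^ hdim := by
      refine le_trans (le_of_eq ?_) (ENNReal.rpow_le_rpow hpow hdim_pos.le)
      rw [← ENNReal.rpow_natCast, ← ENNReal.rpow_natCast, ← ENNReal.rpow_mul, mul_comm _ hdim,
        ENNReal.rpow_mul, ennreal_half_rpow_hdim]
    have h4 : codedMeasure s ≤ 3 * 3⁻¹ ^ n := by
      rcases Nat.eq_zero_or_pos n with h | h
      · rw [h]; exact prob_le_one.trans (by norm_num)
      · refine hle n ?_
        have := Nat.find_min hex (m := n - 1) (by omega)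
        rw [show n - 1 + 2 = n + 1 by omega] at this
        exact not_le.1 this
    refine h4.trans (le_trans (le_of_eq ?_) (mul_le_mul_right h3 27))
    rw [pow_add, show (27 : ℝ≥0∞) = 3 * (3 * 3) by norm_num]
    have : (3 : ℝ≥0∞) * 3⁻¹ = 1 := ENNReal.mul_inv_cancel (by simp) (by simp)
    calc (3 : ℝ≥0∞) * 3⁻¹ ^ n = 3 * 3⁻¹ ^ n * ((3 * 3⁻¹) * (3 * 3⁻¹)) := by rw [this]; simp
      _ = _ := by ring

/-- Mass distribution principle. The scale `4⁻¹` is arbitrary, since the mass bound holds for sets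
of any diameter. -/
lemma hausdorffMeasure_gasket_ne_zero : μH[hdim] gasket ≠ 0 := by
  have h : (27⁻¹ : ℝ≥0∞) • codedMeasure ≤ μH[hdim] :=
    Measure.le_hausdorffMeasure hdim _ 4⁻¹ (by simp) fun s _ => by
      rw [Measure.smul_apply, smul_eq_mul, ENNReal.inv_mul_le_iff (by simp) (by simp)]
      exact codedMeasure_le_ediam s
  have h1 : codedMeasure gasket = 1 :=
    (prob_compl_eq_zero_iff gasket_isCompact.isClosed.measurableSet).1 codedMeasure_compl_gasket
  have h2 := h gasket
  rw [Measure.smul_apply, h1] at h2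
  intro h0
  rw [h0] at h2
  simp at h2

/-! ### The normalized Hausdorff measure -/

instance : IsProbabilityMeasure hausdorffProb :=
  ⟨by simpa [hausdorffProb] using
    ENNReal.inv_mul_cancel hausdorffMeasure_gasket_ne_zero hausdorffMeasure_gasket_ne_top⟩

lemma measurableSet_gasket : MeasurableSet gasket := gasket_isCompact.isClosed.measurableSet

lemma ae_mem_gasket : ∀ᵐ x ∂hausdorffProb, x ∈ gasket :=
  Measure.ae_smul_measure (ae_restrict_mem measurableSet_gasket) _

lemma hausdorffProb_cell (w : List (Fin 3)) : hausdorffProb (cell w) = 3⁻¹ ^ w.length := by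
  rw [hausdorffProb, Measure.smul_apply, Measure.restrict_apply (measurableSet_cell w),
    inter_eq_self_of_subset_left (cell_subset_gasket w), hausdorffMeasure_cell, smul_eq_mul,
    mul_left_comm,
    ENNReal.inv_mul_cancel hausdorffMeasure_gasket_ne_zero hausdorffMeasure_gasket_ne_top, mul_one]

/-- The cells `K_i` cover the gasket, so subadditivity and scaling suffice. Only upper bounds are
derived from it, so it need not be shown that the overlaps are null. -/
lemma hausdorffProb_le : hausdorffProb ≤ ∑ i, (3⁻¹ : ℝ≥0∞) • hausdorffProb.map (contr i) := by
  refine Measure.le_iff.2 fun s hs => ?_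
  simp only [Measure.coe_finsetSum, Finset.sum_apply, Measure.smul_apply, smul_eq_mul]
  have h : ∀ i, 3⁻¹ * (hausdorffProb.map (contr i)) s =
      (μH[hdim] gasket)⁻¹ * μH[hdim] (s ∩ contr i '' gasket) := fun i => by
    have hm := (continuous_contr i).measurable
    rw [Measure.map_apply hm hs, hausdorffProb, Measure.smul_apply, Measure.restrict_apply (hm hs),
      ← image_preimage_inter, hausdorffMeasure_contr_image, smul_eq_mul, mul_left_comm]
  simp only [h]
  rw [hausdorffProb, Measure.smul_apply, Measure.restrict_apply hs, smul_eq_mul, ← Finset.mul_sum]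
  gcongr
  conv_lhs => rw [gasket_selfSimilar, inter_iUnion]
  exact measure_iUnion_fintype_le _ _

lemma lintegral_hausdorffProb_le {g : Plane → ℝ≥0∞} (hg : Measurable g) :
    ∫⁻ x, g x ∂hausdorffProb ≤ 3⁻¹ * ∑ i, ∫⁻ x, g (contr i x) ∂hausdorffProb := by
  refine (lintegral_mono' hausdorffProb_le le_rfl).trans_eq ?_
  rw [lintegral_finsetSum_measure, Finset.mul_sum]
  refine Finset.sum_congr rfl fun i _ => ?_
  rw [lintegral_smul_measure, lintegral_map hg (continuous_contr i).measurable, smul_eq_mul]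

/-! ### Energy of nearby pairs and the bound for the non-local energy -/

lemma lintegral_lintegral_hausdorffProb_le {g : Plane → Plane → ℝ≥0∞}
    (hg : Measurable (Function.uncurry g)) :
    ∫⁻ x, ∫⁻ y, g x y ∂hausdorffProb ∂hausdorffProb ≤
      9⁻¹ * ∑ i, ∑ j, ∫⁻ x, ∫⁻ y, g (contr i x) (contr j y) ∂hausdorffProb ∂hausdorffProb := by
  have hc := fun i => (continuous_contr i).measurable
  refine (lintegral_hausdorffProb_le (hg.lintegral_prod_right')).trans ?_
  rw [show (9⁻¹ : ℝ≥0∞) = 3⁻¹ * 3⁻¹ by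
    rw [← ENNReal.mul_inv (by simp) (by simp)]; norm_num, mul_assoc]
  gcongr
  rw [Finset.mul_sum]
  refine Finset.sum_le_sum fun i _ => ?_
  have hm : ∀ j, Measurable fun x => ∫⁻ y, g (contr i x) (contr j y) ∂hausdorffProb := fun j =>
    Measurable.lintegral_prod_right' (f := fun z : Plane × Plane => g (contr i z.1) (contr j z.2))
      (hg.comp (((hc i).comp measurable_fst).prodMk ((hc j).comp measurable_snd)))
  refine (lintegral_mono fun x => lintegral_hausdorffProb_le
    (hg.comp (measurable_prodMk_left (x := contr i x)))).trans_eq ?_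
  simp only [Function.comp_apply, Function.uncurry_apply_pair]
  rw [lintegral_const_mul _ (Finset.measurable_fun_sum _ fun j _ => hm j),
    lintegral_finsetSum _ fun j _ => hm j]

/-- The square increment of `u`, restricted to pairs of points at distance below `2⁻⁽ⁿ⁺¹⁾`. -/
def nearDiff (n : ℕ) (u : Plane → ℝ) (x y : Plane) : ℝ≥0∞ :=
  if dist x y < (1 / 2) ^ (n + 1) then ENNReal.ofReal ((u x - u y) ^ 2) else 0

/-- The integral of the square increments of `u` at distance below `2⁻⁽ⁿ⁺¹⁾`. -/
def nearEnergy (n : ℕ) (u : Plane → ℝ) : ℝ≥0∞ :=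
  ∫⁻ x, ∫⁻ y, nearDiff n u x y ∂hausdorffProb ∂hausdorffProb

lemma measurable_nearDiff (n : ℕ) {u : Plane → ℝ} (hu : Continuous u) :
    Measurable (Function.uncurry (nearDiff n u)) := by
  have hm := hu.measurable
  refine Measurable.ite (measurableSet_lt (by fun_prop) measurable_const) ?_ measurable_const
  fun_prop

lemma measurable_nearDiff_right (n : ℕ) {u : Plane → ℝ} (hu : Continuous u) (x : Plane) :
    Measurable (nearDiff n u x) :=
  (measurable_nearDiff n hu).of_uncurry_left

lemma measurable_lintegral_nearDiff (n : ℕ) {u : Plane → ℝ} (hu : Continuous u) :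
    Measurable fun x => ∫⁻ y, nearDiff n u x y ∂hausdorffProb :=
  (measurable_nearDiff n hu).lintegral_prod_right'

lemma lintegral_const_mul_nearDiff (c : ℝ≥0∞) (n : ℕ) {u : Plane → ℝ} (hu : Continuous u)
    (x : Plane) : ∫⁻ y, c * nearDiff n u x y ∂hausdorffProb =
      c * ∫⁻ y, nearDiff n u x y ∂hausdorffProb :=
  lintegral_const_mul c (measurable_nearDiff_right n hu x)

lemma nearDiff_contr_contr_self (n : ℕ) (u : Plane → ℝ) (i : Fin 3) (x y : Plane) :
    nearDiff (n + 1) u (contr i x) (contr i y) = nearDiff n (u ∘ contr i) x y := by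
  unfold nearDiff
  congr 1
  rw [dist_contr, pow_succ _ (n + 1), eq_iff_iff]
  constructor <;> intro h <;> linarith

/-- Nearby points of two different cells are both near the common vertex `f_i(p_j) = f_j(p_i)`, and
`u` is compared with its value there. The constant is `50 = 2 · 25`. -/
lemma nearDiff_contr_contr_le (n : ℕ) {u : Plane → ℝ} (hu : Continuous u) {i j : Fin 3} (hij : i ≠ j)
    {x y : Plane} (hx : x ∈ gasket) (hy : y ∈ gasket) :
    nearDiff (n + 1) u (contr i x) (contr j y) ≤
      (cell (List.replicate n j)).indicator 1 x * ((cell (List.replicate n i)).indicator 1 y *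
        (50 * (localEnergy (u ∘ contr i ∘ wordMap (List.replicate n j)) +
          localEnergy (u ∘ contr j ∘ wordMap (List.replicate n i))))) := by
  unfold nearDiff
  split_ifs with h
  · have h1 := mem_cell_replicate_of_lt_bary hx (lt_bary_of_dist_contr_lt hij hy h)
    rw [dist_comm] at h
    have h2 := mem_cell_replicate_of_lt_bary hy (lt_bary_of_dist_contr_lt hij.symm hx h)
    rw [indicator_of_mem h1, indicator_of_mem h2, Pi.one_apply, Pi.one_apply, one_mul, one_mul]
    obtain ⟨x', hx', rfl⟩ := h1
    obtain ⟨y', hy', rfl⟩ := h2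
    have hc : ∀ i j, Continuous (u ∘ contr i ∘ wordMap (List.replicate n j)) := fun i j =>
      hu.comp ((continuous_contr i).comp (continuous_wordMap _))
    have h3 := ofReal_sq_sub_corner_le (hc i j).continuousOn hx' j
    have h4 := ofReal_sq_sub_corner_le (hc j i).continuousOn hy' i
    simp only [Function.comp_apply, wordMap_replicate_corner] at h3 h4
    rw [contr_corner_comm j i] at h4
    refine (ofReal_sq_sub_le_add _ _ _).trans ((add_le_add (mul_le_mul_right h3 2)
      (mul_le_mul_right h4 2)).trans_eq ?_)
    ring
  · exact zero_le

lemma lintegral_nearDiff_contr_contr_le (n : ℕ) {u : Plane → ℝ} (hu : Continuous u) {i j : Fin 3}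
    (hij : i ≠ j) :
    ∫⁻ x, ∫⁻ y, nearDiff (n + 1) u (contr i x) (contr j y) ∂hausdorffProb ∂hausdorffProb ≤
      9⁻¹ ^ n * (50 * (localEnergy (u ∘ contr i ∘ wordMap (List.replicate n j)) +
          localEnergy (u ∘ contr j ∘ wordMap (List.replicate n i)))) := by
  set c := 50 * (localEnergy (u ∘ contr i ∘ wordMap (List.replicate n j)) +
          localEnergy (u ∘ contr j ∘ wordMap (List.replicate n i)))
  calc _ ≤ ∫⁻ x, ∫⁻ y, (cell (List.replicate n j)).indicator 1 x *
        ((cell (List.replicate n i)).indicator 1 y * c) ∂hausdorffProb ∂hausdorffProb := by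
        refine lintegral_mono_ae (ae_mem_gasket.mono fun x hx => ?_)
        exact lintegral_mono_ae (ae_mem_gasket.mono fun y hy =>
          nearDiff_contr_contr_le n hu hij hx hy)
    _ = _ := by
        have hm : ∀ w, Measurable ((cell w).indicator (1 : Plane → ℝ≥0∞)) := fun w =>
          measurable_one.indicator (measurableSet_cell w)
        have h1 : ∀ x, ∫⁻ y, (cell (List.replicate n j)).indicator 1 x *
            ((cell (List.replicate n i)).indicator 1 y * c) ∂hausdorffProb =
            (cell (List.replicate n j)).indicator 1 x * (3⁻¹ ^ n * c) := fun x => by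
          rw [lintegral_const_mul _ ((hm _).mul_const c), lintegral_mul_const _ (hm _),
            lintegral_indicator_one (measurableSet_cell _), hausdorffProb_cell, List.length_replicate]
        simp only [h1]
        rw [lintegral_mul_const _ (hm _), lintegral_indicator_one (measurableSet_cell _),
          hausdorffProb_cell, List.length_replicate, ← mul_assoc, ← mul_pow,
          ← ENNReal.mul_inv (by simp) (by simp)]
        norm_num

lemma nearEnergy_succ_le (n : ℕ) {u : Plane → ℝ} (hu : Continuous u) :
    nearEnergy (n + 1) u ≤ 9⁻¹ * ∑ i, (nearEnergy n (u ∘ contr i) +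
      9⁻¹ ^ n * (100 * ∑ j ∈ Finset.univ.filter (· ≠ i),
        localEnergy (u ∘ contr i ∘ wordMap (List.replicate n j)))) := by
  refine (lintegral_lintegral_hausdorffProb_le (measurable_nearDiff (n + 1) hu)).trans ?_
  refine mul_le_mul_right ?_ _
  set e : Fin 3 → Fin 3 → ℝ≥0∞ := fun i j =>
    localEnergy (u ∘ contr i ∘ wordMap (List.replicate n j)) with he
  have h : ∀ i j, ∫⁻ x, ∫⁻ y, nearDiff (n + 1) u (contr i x) (contr j y) ∂hausdorffProb
      ∂hausdorffProb ≤ if j = i then nearEnergy n (u ∘ contr i) else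
        9⁻¹ ^ n * (50 * (e i j + e j i)) := fun i j => by
    split_ifs with hij
    · subst hij
      simp only [nearDiff_contr_contr_self]
      exact le_rfl
    · exact lintegral_nearDiff_contr_contr_le n hu (Ne.symm hij)
  refine (Finset.sum_le_sum fun i _ => Finset.sum_le_sum fun j _ => h i j).trans_eq ?_
  simp only [Finset.sum_filter, Fin.sum_univ_three]
  simp
  ring

/-- The extra corner term is what closes the induction: `nearEnergy_succ_le` produces the energies
of the cells `i j…j` with `j ≠ i`, and the corner term supplies the missing `j = i`. Bounding the
cross terms separately at each step would add a factor `n`, and the resulting series would be of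
order `(1 - x)⁻²`. The base case gives `400 = 100 + 3 · 100`. -/
lemma nearEnergy_add_le (n : ℕ) {u : Plane → ℝ} (hu : Continuous u) :
    nearEnergy n u + 9⁻¹ ^ n * (100 * ∑ j, localEnergy (u ∘ wordMap (List.replicate n j))) ≤
      9⁻¹ ^ n * (400 * ((3 / 5) ^ n * localEnergy u)) := by
  induction n generalizing u with
  | zero =>
    have h : nearEnergy 0 u ≤ 100 * localEnergy u := by
      have hle : nearEnergy 0 u ≤
          ∫⁻ _, ∫⁻ _, 100 * localEnergy u ∂hausdorffProb ∂hausdorffProb := by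
        refine lintegral_mono_ae (ae_mem_gasket.mono fun x hx => ?_)
        refine lintegral_mono_ae (ae_mem_gasket.mono fun y hy => ?_)
        unfold nearDiff
        split_ifs
        · exact ofReal_sq_sub_le hu.continuousOn hx hy
        · exact zero_le
      simpa using hle
    simp only [pow_zero, one_mul, List.replicate_zero, wordMap, Function.comp_id, Finset.sum_const,
      Finset.card_univ, Fintype.card_fin, nsmul_eq_mul]
    refine (add_le_add_left h _).trans_eq ?_
    push_cast
    ring
  | succ n ih =>
    calc _ ≤ 9⁻¹ * ∑ i, (nearEnergy n (u ∘ contr i) +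
          9⁻¹ ^ n * (100 * ∑ j ∈ Finset.univ.filter (· ≠ i),
            localEnergy (u ∘ contr i ∘ wordMap (List.replicate n j)))) +
          9⁻¹ ^ (n + 1) * (100 * ∑ j, localEnergy (u ∘ wordMap (List.replicate (n + 1) j))) := by
          gcongr; exact nearEnergy_succ_le n hu
      _ = 9⁻¹ * ∑ i, (nearEnergy n (u ∘ contr i) + 9⁻¹ ^ n * (100 * ∑ j,
            localEnergy ((u ∘ contr i) ∘ wordMap (List.replicate n j)))) := by
          simp only [Finset.sum_filter, Fin.sum_univ_three, List.replicate_succ, wordMap,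
            Function.comp_assoc]
          simp
          ring
      _ ≤ 9⁻¹ * ∑ i, 9⁻¹ ^ n * (400 * ((3 / 5) ^ n * localEnergy (u ∘ contr i))) := by
          gcongr with i; exact ih (hu.comp (continuous_contr i))
      _ = _ := by
          rw [← Finset.mul_sum, ← Finset.mul_sum, ← Finset.mul_sum, sum_localEnergy_contr]
          ring

lemma nearEnergy_le (n : ℕ) {u : Plane → ℝ} (hu : Continuous u) :
    nearEnergy n u ≤ 15⁻¹ ^ n * (400 * localEnergy u) := by
  refine (le_self_add.trans (nearEnergy_add_le n hu)).trans_eq ?_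
  have : (15⁻¹ : ℝ≥0∞) = 9⁻¹ * (3 / 5) := by
    rw [show (9 : ℝ≥0∞) = 3 * 3 by norm_num, show (15 : ℝ≥0∞) = 3 * 5 by norm_num,
      ENNReal.mul_inv (by simp) (by simp), ENNReal.mul_inv (by simp) (by simp), div_eq_mul_inv]
    rw [mul_assoc, ← mul_assoc (3⁻¹ : ℝ≥0∞) 3, ENNReal.inv_mul_cancel (by simp) (by simp), one_mul]
  rw [this, mul_pow]
  ring

/-- A pair at distance in `(2⁻⁽ⁿ⁺³⁾, 2⁻⁽ⁿ⁺²⁾]` is accounted for by the `n`-th term of the series,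
and a pair at distance above `1/4` by the first summand. -/
lemma ofReal_div_dist_rpow_le (u : Plane → ℝ) {s : ℝ} (hs : 0 ≤ s) (x y : Plane) :
    ENNReal.ofReal ((u x - u y) ^ 2 / dist x y ^ s) ≤
      ENNReal.ofReal (2 ^ s) ^ 2 * ENNReal.ofReal ((u x - u y) ^ 2) +
        ∑' n, ENNReal.ofReal (2 ^ s) ^ (n + 3) * nearDiff n u x y := by
  have key : ∀ k : ℕ, (1 / 2) ^ k ≤ dist x y → ENNReal.ofReal ((u x - u y) ^ 2 / dist x y ^ s) ≤
      ENNReal.ofReal (2 ^ s) ^ k * ENNReal.ofReal ((u x - u y) ^ 2) := fun k hk => by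
    rw [← ENNReal.ofReal_pow (by positivity), ← ENNReal.ofReal_mul (by positivity)]
    refine ENNReal.ofReal_le_ofReal ?_
    have h1 : ((1 / 2 : ℝ) ^ k) ^ s ≤ dist x y ^ s := Real.rpow_le_rpow (by positivity) hk hs
    have h2 : ((1 / 2 : ℝ) ^ k) ^ s = ((2 ^ s) ^ k)⁻¹ := by
      rw [one_div, ← Real.rpow_natCast, ← Real.rpow_natCast, ← Real.rpow_mul (by norm_num),
        ← Real.rpow_mul (by norm_num), Real.inv_rpow (by norm_num), mul_comm]
    rw [h2] at h1
    calc _ ≤ (u x - u y) ^ 2 / ((2 ^ s) ^ k)⁻¹ := by gcongr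
      _ = _ := by rw [div_inv_eq_mul, mul_comm]
  rcases eq_or_ne x y with rfl | hxy
  · simp
  by_cases h4 : dist x y ≤ 1 / 4
  · obtain ⟨n, h1, h2⟩ := exists_nat_pow_near_of_lt_one (x := 4 * dist x y) (y := (1 / 2 : ℝ))
      (by have := dist_pos.2 hxy; positivity) (by linarith) (by norm_num) (by norm_num)
    have hp : (0 : ℝ) < (1 / 2) ^ n := by positivity
    have h3 : nearDiff n u x y = ENNReal.ofReal ((u x - u y) ^ 2) := by
      rw [nearDiff, if_pos]; rw [pow_succ]; linarith
    refine le_trans ?_ (le_trans (ENNReal.le_tsum n) le_add_self)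
    rw [h3]
    exact key (n + 3) (by rw [pow_succ] at h1; rw [pow_add]; linarith)
  · exact (key 2 (by norm_num; linarith)).trans le_self_add

/-- The full non-local energy with constant coefficient is controlled by the local energy. -/
lemma lintegral_div_dist_rpow_le {u : Plane → ℝ} (hu : Continuous u) {β : ℝ} (hβ : 0 ≤ β)
    (hlt : (2 : ℝ) ^ β / 5 < 1) :
    ENNReal.ofReal (1 - 2 ^ β / 5) * ∫⁻ x, ∫⁻ y, ENNReal.ofReal
      ((u x - u y) ^ 2 / dist x y ^ (hdim + β)) ∂hausdorffProb ∂hausdorffProb ≤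
      1372500 * localEnergy u := by
  set L := ENNReal.ofReal (2 ^ β / 5) with hL
  -- The growth `15ⁿ` of the kernel over the scales exactly cancels the decay `15⁻ⁿ` of
  -- `nearEnergy`, leaving `Lⁿ`. The constants below are `22500 = 15² · 100` and `1350000 = 15³ ·
  -- 400`.
  have hK : ENNReal.ofReal (2 ^ (hdim + β)) = 15 * L := by
    rw [Real.rpow_add (by norm_num), two_rpow_hdim, hL, show (15 : ℝ≥0∞) = ENNReal.ofReal 15 by simp,
      ← ENNReal.ofReal_mul (by norm_num)]
    congr 1; ring
  have hL1 : L ≤ 1 := by rw [hL]; exact ENNReal.ofReal_le_one.2 hlt.le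
  have hsub : ENNReal.ofReal (1 - 2 ^ β / 5) = 1 - L := by
    rw [ENNReal.ofReal_sub _ (by positivity), ENNReal.ofReal_one]
  have hmd : ∀ n, Measurable fun x => ∫⁻ y, (15 * L) ^ (n + 3) * nearDiff n u x y ∂hausdorffProb :=
    fun n => by
      simp only [lintegral_const_mul_nearDiff _ n hu]
      exact (measurable_lintegral_nearDiff n hu).const_mul _
  have hnear : ∀ n, ∫⁻ x, ∫⁻ y, (15 * L) ^ (n + 3) * nearDiff n u x y ∂hausdorffProb
      ∂hausdorffProb ≤ 1350000 * localEnergy u * L ^ n := fun n => by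
    simp only [lintegral_const_mul_nearDiff _ n hu]
    rw [lintegral_const_mul _ (measurable_lintegral_nearDiff n hu)]
    calc _ ≤ (15 * L) ^ (n + 3) * (15⁻¹ ^ n * (400 * localEnergy u)) := by
          gcongr; exact nearEnergy_le n hu
      _ = (15 * 15⁻¹) ^ n * (L ^ 3 * (1350000 * localEnergy u * L ^ n)) := by
          generalize (15⁻¹ : ℝ≥0∞) = c
          ring
      _ ≤ _ := by
          rw [ENNReal.mul_inv_cancel (by simp) (by simp), one_pow, one_mul]
          exact mul_le_of_le_one_left zero_le (pow_le_one₀ zero_le hL1)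
  calc _ ≤ (1 - L) * ∫⁻ x, ∫⁻ y, ((15 * L) ^ 2 * (100 * localEnergy u) +
          ∑' n, (15 * L) ^ (n + 3) * nearDiff n u x y) ∂hausdorffProb ∂hausdorffProb := by
        rw [hsub]
        gcongr 1
        refine lintegral_mono_ae (ae_mem_gasket.mono fun x hx => ?_)
        refine lintegral_mono_ae (ae_mem_gasket.mono fun y hy => ?_)
        refine (ofReal_div_dist_rpow_le u (add_nonneg hdim_pos.le hβ) x y).trans ?_
        rw [hK]
        gcongr
        exact ofReal_sq_sub_le hu.continuousOn hx hy
    _ = (1 - L) * ((15 * L) ^ 2 * (100 * localEnergy u) +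
          ∑' n, ∫⁻ x, ∫⁻ y, (15 * L) ^ (n + 3) * nearDiff n u x y ∂hausdorffProb
            ∂hausdorffProb) := by
        have : ∀ x, ∫⁻ y, ((15 * L) ^ 2 * (100 * localEnergy u) +
            ∑' n, (15 * L) ^ (n + 3) * nearDiff n u x y) ∂hausdorffProb =
            (15 * L) ^ 2 * (100 * localEnergy u) +
            ∑' n, ∫⁻ y, (15 * L) ^ (n + 3) * nearDiff n u x y ∂hausdorffProb := fun x => by
          rw [lintegral_add_left measurable_const, lintegral_const, measure_univ, mul_one,
            lintegral_tsum fun n => ((measurable_nearDiff_right n hu x).const_mul _).aemeasurable]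
        simp only [this]
        rw [lintegral_add_left measurable_const, lintegral_const, measure_univ, mul_one,
            lintegral_tsum fun n => (hmd n).aemeasurable]
    _ ≤ (1 - L) * (22500 * localEnergy u + 1350000 * localEnergy u * (1 - L)⁻¹) := by
        refine mul_le_mul_right (add_le_add ?_ ((ENNReal.tsum_le_tsum hnear).trans_eq ?_)) _
        · rw [mul_pow, show (15 ^ 2 * L ^ 2 * (100 * localEnergy u)) =
            L ^ 2 * (22500 * localEnergy u) by ring]
          exact mul_le_of_le_one_left zero_le (pow_le_one₀ zero_le hL1)
        · rw [ENNReal.tsum_mul_left, ENNReal.tsum_geometric]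
    _ ≤ 22500 * localEnergy u + 1350000 * localEnergy u := by
        rw [mul_add, mul_left_comm (1 - L) (1350000 * localEnergy u)]
        exact add_le_add (mul_le_of_le_one_left zero_le tsub_le_self)
          (mul_le_of_le_one_right zero_le (ENNReal.mul_inv_le_one _))
    _ = _ := by rw [← add_mul]; norm_num

/-! ### The energy of the vertex kernel -/

lemma wordMap_append_replicate_corner (w : List (Fin 3)) (m : ℕ) (j : Fin 3) :
    wordMap (w ++ List.replicate m j) (corner j) = wordMap w (corner j) := by
  rw [wordMap_append, Function.comp_apply, wordMap_replicate_corner]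

lemma le_mul_mul_of_one_le {γ n : ℕ} (hγ : 1 ≤ γ) (hn : 1 ≤ n) (i : ℕ) : i ≤ γ * n * i :=
  Nat.le_mul_of_pos_left i (Nat.mul_pos hγ hn)

lemma dist_corner_of_mem_cornerCell {γ i n : ℕ} (hγ : 1 ≤ γ) (hn : 1 ≤ n) {w : Fin n → Fin 3}
    {j : Fin 3} {x : Plane} (hx : x ∈ cornerCell γ i w j) :
    dist x (wordMap (List.ofFn w) (corner j)) ≤ (1 / 2) ^ n * (1 / 2) ^ i := by
  obtain ⟨x', hx', rfl⟩ := hx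
  rw [← wordMap_append_replicate_corner (List.ofFn w) (γ * n * i) j, dist_wordMap,
    List.length_append, List.length_ofFn, List.length_replicate, pow_add]
  have h : (1 / 2 : ℝ) ^ (γ * n * i) ≤ (1 / 2) ^ i :=
    pow_le_pow_of_le_one (by norm_num) (by norm_num) (le_mul_mul_of_one_le hγ hn i)
  calc _ ≤ (1 / 2 : ℝ) ^ n * (1 / 2) ^ (γ * n * i) * 1 := by gcongr; exact dist_corner_le hx' j
    _ ≤ _ := by rw [mul_one]; gcongr

lemma abs_dist_sub_le_of_mem_cornerCell {γ i n : ℕ} (hγ : 1 ≤ γ) (hn : 1 ≤ n) {w : Fin n → Fin 3}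
    {j k : Fin 3} (hjk : j ≠ k) {x y : Plane} (hx : x ∈ cornerCell γ i w j)
    (hy : y ∈ cornerCell γ i w k) :
    |dist x y - (1 / 2) ^ n| ≤ (1 / 2) ^ n * (2 * (1 / 2) ^ i) := by
  have h := dist_dist_dist_le x y (wordMap (List.ofFn w) (corner j))
    (wordMap (List.ofFn w) (corner k))
  rw [dist_wordMap, dist_corner_corner hjk, mul_one, List.length_ofFn, Real.dist_eq] at h
  linarith [dist_corner_of_mem_cornerCell hγ hn hx, dist_corner_of_mem_cornerCell hγ hn hy]

lemma toReal_three_div_five_pow (n : ℕ) : ((3 / 5 : ℝ≥0∞) ^ n).toReal = (3 / 5) ^ n := by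
  rw [← ofReal_three_div_five, ENNReal.toReal_pow, ENNReal.toReal_ofReal (by norm_num)]

lemma three_div_five_pow_ne_top (n : ℕ) : (3 / 5 : ℝ≥0∞) ^ n ≠ ∞ := by
  rw [← ofReal_three_div_five]
  exact ENNReal.pow_ne_top ENNReal.ofReal_ne_top

lemma localEnergy_wordMap_ne_top {u : Plane → ℝ} (hE : localEnergy u ≠ ∞) (w : List (Fin 3)) :
    localEnergy (u ∘ wordMap w) ≠ ∞ := by
  refine ((localEnergy_wordMap_le w u).trans_lt (ENNReal.mul_lt_top
    (three_div_five_pow_ne_top _).lt_top hE.lt_top)).ne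

/-- The small cell arises from `K_w` by `γ n i ≥ i` further subdivisions, each reducing the energy
by at least the factor `3/5`; the oscillation bound is applied on it. -/
lemma sq_sub_le_of_mem_cornerCell {u : Plane → ℝ} (hu : Continuous u) (hE : localEnergy u ≠ ∞)
    {γ i n : ℕ} (hγ : 1 ≤ γ) (hn : 1 ≤ n) {w : Fin n → Fin 3} {j : Fin 3} {x : Plane}
    (hx : x ∈ cornerCell γ i w j) :
    (u x - u (wordMap (List.ofFn w) (corner j))) ^ 2 ≤
      25 * ((3 / 5) ^ i * (localEnergy (u ∘ wordMap (List.ofFn w))).toReal) := by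
  obtain ⟨x', hx', rfl⟩ := hx
  set m := γ * n * i with hm
  have hE' := localEnergy_wordMap_ne_top hE (List.ofFn w)
  have h := ofReal_sq_sub_corner_le
    (hu.comp (continuous_wordMap (List.ofFn w ++ List.replicate m j))).continuousOn hx' j
  rw [wordMap_append, ← Function.comp_assoc] at h
  have h' := h.trans (mul_le_mul_right (localEnergy_wordMap_le (List.replicate m j) _) 25)
  rw [List.length_replicate, ENNReal.ofReal_le_iff_le_toReal (ENNReal.mul_ne_top (by simp)
    (ENNReal.mul_ne_top (three_div_five_pow_ne_top m) hE')),
    ENNReal.toReal_mul, ENNReal.toReal_mul, toReal_three_div_five_pow] at h'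
  simp only [Function.comp_apply, wordMap_replicate_corner] at h'
  rw [wordMap_append]
  refine h'.trans ?_
  have h2 : (3 / 5 : ℝ) ^ m ≤ (3 / 5) ^ i :=
    pow_le_pow_of_le_one (by norm_num) (by norm_num) (le_mul_mul_of_one_le hγ hn i)
  rw [ENNReal.toReal_ofNat]
  gcongr

lemma sq_add_le {ε : ℝ} (hε : 0 < ε) (b t : ℝ) :
    (b + t) ^ 2 ≤ (1 + ε) * b ^ 2 + (1 + 1 / ε) * t ^ 2 := by
  have h : (1 + ε) * b ^ 2 + (1 + 1 / ε) * t ^ 2 - (b + t) ^ 2 = (ε * b - t) ^ 2 / ε := by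
    field_simp; ring
  have : 0 ≤ (ε * b - t) ^ 2 / ε := by positivity
  linarith

lemma le_sq_add {ε : ℝ} (hε : 0 < ε) (b t : ℝ) :
    (1 - ε) * b ^ 2 - 1 / ε * t ^ 2 ≤ (b + t) ^ 2 := by
  have h : (b + t) ^ 2 - ((1 - ε) * b ^ 2 - 1 / ε * t ^ 2) = (ε * b + t) ^ 2 / ε + t ^ 2 := by
    field_simp; ring
  have : 0 ≤ (ε * b + t) ^ 2 / ε + t ^ 2 := by positivity
  linarith

/-- The increments between two corner cells are close to those between the corners. -/
lemma sq_sub_bounds {u : Plane → ℝ} (hu : Continuous u) (hE : localEnergy u ≠ ∞)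
    {γ i n : ℕ} (hγ : 1 ≤ γ) (hn : 1 ≤ n) {w : Fin n → Fin 3} {j k : Fin 3} {x y : Plane}
    (hx : x ∈ cornerCell γ i w j) (hy : y ∈ cornerCell γ i w k) {ε : ℝ} (hε : 0 < ε) :
    (1 - ε) * (u (wordMap (List.ofFn w) (corner j)) - u (wordMap (List.ofFn w) (corner k))) ^ 2 -
        1 / ε * (100 * ((3 / 5) ^ i * (localEnergy (u ∘ wordMap (List.ofFn w))).toReal)) ≤
      (u x - u y) ^ 2 ∧ (u x - u y) ^ 2 ≤
    (1 + ε) * (u (wordMap (List.ofFn w) (corner j)) - u (wordMap (List.ofFn w) (corner k))) ^ 2 +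
      (1 + 1 / ε) * (100 * ((3 / 5) ^ i * (localEnergy (u ∘ wordMap (List.ofFn w))).toReal)) := by
  have h1 := sq_sub_le_of_mem_cornerCell hu hE hγ hn hx
  have h2 := sq_sub_le_of_mem_cornerCell hu hE hγ hn hy
  set a := u (wordMap (List.ofFn w) (corner j))
  set b := u (wordMap (List.ofFn w) (corner k))
  set e := (3 / 5) ^ i * (localEnergy (u ∘ wordMap (List.ofFn w))).toReal
  have ht : (u x - u y - (a - b)) ^ 2 ≤ 100 * e := by
    nlinarith [sq_nonneg (u x - a + (u y - b))]
  have h3 := sq_add_le hε (a - b) (u x - u y - (a - b))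
  have h4 := le_sq_add hε (a - b) (u x - u y - (a - b))
  rw [add_sub_cancel] at h3 h4
  have hε' : 0 < 1 / ε := by positivity
  constructor
  · have := mul_le_mul_of_nonneg_left ht hε'.le
    linarith
  · have := mul_le_mul_of_nonneg_left ht (by linarith : 0 ≤ 1 + 1 / ε)
    linarith

/-- Distances between two corner cells, to the power `s`, are close to the power of the scale. -/
lemma div_rpow_bounds {d ρ s : ℝ} {n : ℕ} (hd : |d - (1 / 2) ^ n| ≤ (1 / 2) ^ n * ρ) (hρ0 : 0 ≤ ρ)
    (hρ : ρ < 1) (hs0 : 0 ≤ s) (hs : s ≤ 5) {a : ℝ} (ha : 0 ≤ a) :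
    (2 ^ s) ^ n * (a / (1 + ρ) ^ 5) ≤ a / d ^ s ∧ a / d ^ s ≤ (2 ^ s) ^ n * (a / (1 - ρ) ^ 5) := by
  have hp : (0 : ℝ) < (1 / 2) ^ n := by positivity
  have hρ' : 0 < 1 - ρ := by linarith
  obtain ⟨h1, h2⟩ := abs_le.1 hd
  have h1' : (1 / 2) ^ n * (1 - ρ) ≤ d := by linarith
  have h2' : d ≤ (1 / 2) ^ n * (1 + ρ) := by linarith
  have hd0 : 0 < d := lt_of_lt_of_le (by positivity) h1'
  have hscale : ((1 / 2 : ℝ) ^ n) ^ s = ((2 ^ s) ^ n)⁻¹ := by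
    rw [one_div, ← Real.rpow_natCast, ← Real.rpow_natCast, ← Real.rpow_mul (by norm_num),
      ← Real.rpow_mul (by norm_num), Real.inv_rpow (by norm_num), mul_comm]
  have h5 : (5 : ℝ) = ((5 : ℕ) : ℝ) := by norm_num
  have hup : d ^ s ≤ ((2 ^ s) ^ n)⁻¹ * (1 + ρ) ^ 5 := by
    refine (Real.rpow_le_rpow hd0.le h2' hs0).trans ?_
    rw [Real.mul_rpow hp.le (by linarith), hscale]
    gcongr
    rw [← Real.rpow_natCast, ← h5]
    exact Real.rpow_le_rpow_of_exponent_le (by linarith) hs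
  have hlo : ((2 ^ s) ^ n)⁻¹ * (1 - ρ) ^ 5 ≤ d ^ s := by
    refine le_trans ?_ (Real.rpow_le_rpow (by positivity) h1' hs0)
    rw [Real.mul_rpow hp.le hρ'.le, hscale]
    gcongr
    rw [← Real.rpow_natCast, ← h5]
    exact Real.rpow_le_rpow_of_exponent_ge hρ' (by linarith) hs
  have hds : 0 < d ^ s := Real.rpow_pos_of_pos hd0 s
  have hpos : (0 : ℝ) < (2 ^ s) ^ n := by positivity
  constructor
  · calc _ = a / (((2 ^ s) ^ n)⁻¹ * (1 + ρ) ^ 5) := by field_simp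
      _ ≤ _ := by gcongr
  · calc _ ≤ a / (((2 ^ s) ^ n)⁻¹ * (1 - ρ) ^ 5) := by gcongr
      _ = _ := by field_simp

/-- The weight of the kernel times the singularity at distance `2⁻ⁿ`: the factor `(5/3)ⁿ` turns the
sum of squares into `discreteEnergy n`, and the rest is the Abelian weight. -/
lemma two_rpow_scale (β : ℝ) (n : ℕ) :
    (2 : ℝ) ^ (-2 * hdim * (n : ℝ)) * (2 ^ (hdim + β)) ^ n = (2 ^ β / 5) ^ n * (5 / 3) ^ n := by
  rw [Real.rpow_mul_natCast (by norm_num), ← mul_pow, ← mul_pow, ← Real.rpow_add (by norm_num),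
    show -2 * hdim + (hdim + β) = β - hdim by ring, Real.rpow_sub (by norm_num), two_rpow_hdim]
  congr 1; ring

/-- One summand of the energy density of the vertex kernel. -/
def pairDensity (γ i : ℕ) (β : ℝ) (u : Plane → ℝ) (n : ℕ) (w : Fin n → Fin 3) (j k : Fin 3)
    (x y : Plane) : ℝ :=
  (2 : ℝ) ^ (-2 * hdim * (n : ℝ)) *
    (1 / (hausdorffProb.real (cornerCell γ i w j) * hausdorffProb.real (cornerCell γ i w k)) *
      ((cornerCell γ i w j).indicator (fun _ => (1 : ℝ)) x *
        (cornerCell γ i w k).indicator (fun _ => (1 : ℝ)) y)) *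
    ((u x - u y) ^ 2 / dist x y ^ (hdim + β))

/-- The contribution of the words of length `n` to the energy of the vertex kernel. -/
def levelEnergy (γ i : ℕ) (β : ℝ) (u : Plane → ℝ) (n : ℕ) : ℝ≥0∞ :=
  ∑ w : Fin n → Fin 3, ∑ j : Fin 3, ∑ k ∈ Finset.univ.filter (fun k : Fin 3 => k ≠ j),
    ∫⁻ z : Plane × Plane, ENNReal.ofReal (pairDensity γ i β u n w j k z.1 z.2)
      ∂(hausdorffProb.prod hausdorffProb)

lemma pairDensity_nonneg (γ i : ℕ) (β : ℝ) (u : Plane → ℝ) (n : ℕ) (w : Fin n → Fin 3) (j k : Fin 3)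
    (x y : Plane) : 0 ≤ pairDensity γ i β u n w j k x y := by
  have : ∀ (s : Set Plane) (x : Plane), 0 ≤ s.indicator (fun _ => (1 : ℝ)) x := fun s x =>
    indicator_nonneg (fun _ _ => zero_le_one) x
  have h1 := this (cornerCell γ i w j) x
  have h2 := this (cornerCell γ i w k) y
  unfold pairDensity
  positivity

lemma measurableSet_cornerCell (γ i : ℕ) {n : ℕ} (w : Fin n → Fin 3) (j : Fin 3) :
    MeasurableSet (cornerCell γ i w j) := measurableSet_cell _

lemma measurable_div_dist_rpow {u : Plane → ℝ} (hu : Continuous u) (s : ℝ) :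
    Measurable fun z : Plane × Plane => (u z.1 - u z.2) ^ 2 / dist z.1 z.2 ^ s := by
  have := hu.measurable
  fun_prop

lemma measurable_pairDensity (γ i : ℕ) (β : ℝ) {u : Plane → ℝ} (hu : Continuous u) (n : ℕ)
    (w : Fin n → Fin 3) (j k : Fin 3) :
    Measurable fun z : Plane × Plane => pairDensity γ i β u n w j k z.1 z.2 := by
  have h : ∀ j, Measurable ((cornerCell γ i w j).indicator (fun _ => (1 : ℝ))) := fun j =>
    measurable_const.indicator (measurableSet_cornerCell γ i w j)
  exact ((((h j).comp measurable_fst).mul ((h k).comp measurable_snd)).const_mul _ |>.const_mul _).mul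
    (measurable_div_dist_rpow hu _)

lemma hausdorffProb_real_cornerCell_pos (γ i : ℕ) {n : ℕ} (w : Fin n → Fin 3) (j : Fin 3) :
    0 < hausdorffProb.real (cornerCell γ i w j) := by
  rw [Measure.real, cornerCell, hausdorffProb_cell]
  exact ENNReal.toReal_pos (by simp) (ENNReal.pow_ne_top (by simp))

/-- Dividing by `ν(K_p) ν(K_q)` makes the integral an average over `K_p × K_q`, so pointwise bounds
there pass to it unchanged. -/
lemma lintegral_pairDensity_bounds (γ i : ℕ) (β : ℝ) (u : Plane → ℝ) (n : ℕ) (w : Fin n → Fin 3)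
    (j k : Fin 3) {lo hi : ℝ}
    (h : ∀ x ∈ cornerCell γ i w j, ∀ y ∈ cornerCell γ i w k,
      lo ≤ (2 : ℝ) ^ (-2 * hdim * (n : ℝ)) * ((u x - u y) ^ 2 / dist x y ^ (hdim + β)) ∧
      (2 : ℝ) ^ (-2 * hdim * (n : ℝ)) * ((u x - u y) ^ 2 / dist x y ^ (hdim + β)) ≤ hi) :
    ENNReal.ofReal lo ≤ ∫⁻ z : Plane × Plane, ENNReal.ofReal (pairDensity γ i β u n w j k z.1 z.2)
      ∂(hausdorffProb.prod hausdorffProb) ∧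
    ∫⁻ z : Plane × Plane, ENNReal.ofReal (pairDensity γ i β u n w j k z.1 z.2)
      ∂(hausdorffProb.prod hausdorffProb) ≤ ENNReal.ofReal hi := by
  set A := cornerCell γ i w j with hA
  set B := cornerCell γ i w k with hB
  have hAp : 0 < hausdorffProb.real A := hausdorffProb_real_cornerCell_pos γ i w j
  have hBp : 0 < hausdorffProb.real B := hausdorffProb_real_cornerCell_pos γ i w k
  have hAB : MeasurableSet (A ×ˢ B) :=
    (measurableSet_cornerCell γ i w j).prod (measurableSet_cornerCell γ i w k)
  set m := hausdorffProb.real A * hausdorffProb.real B with hm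
  have hmp : 0 < m := by positivity
  have hint : ∀ c : ℝ, ∫⁻ z : Plane × Plane, (A ×ˢ B).indicator (fun _ => ENNReal.ofReal (c / m)) z
      ∂(hausdorffProb.prod hausdorffProb) = ENNReal.ofReal c := fun c => by
    rw [lintegral_indicator_const hAB, Measure.prod_prod,
      ← ENNReal.ofReal_toReal (measure_ne_top hausdorffProb A),
      ← ENNReal.ofReal_toReal (measure_ne_top hausdorffProb B),
      ← ENNReal.ofReal_mul ENNReal.toReal_nonneg, ← ENNReal.ofReal_mul' (by positivity)]
    congr 1
    exact div_mul_cancel₀ c hmp.ne'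
  have hval : ∀ z : Plane × Plane, z ∈ A ×ˢ B → pairDensity γ i β u n w j k z.1 z.2 =
      ((2 : ℝ) ^ (-2 * hdim * (n : ℝ)) * ((u z.1 - u z.2) ^ 2 / dist z.1 z.2 ^ (hdim + β))) / m :=
    fun z hz => by
      rw [pairDensity, ← hA, ← hB, indicator_of_mem hz.1, indicator_of_mem hz.2]
      ring
  have hval0 : ∀ z : Plane × Plane, z ∉ A ×ˢ B → pairDensity γ i β u n w j k z.1 z.2 = 0 :=
    fun z hz => by
      rw [pairDensity, ← hA, ← hB]
      by_cases h1 : z.1 ∈ A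
      · rw [indicator_of_notMem fun h2 => hz ⟨h1, h2⟩]; simp
      · rw [indicator_of_notMem h1]; simp
  constructor
  · rw [← hint lo]
    refine lintegral_mono fun z => ?_
    by_cases hz : z ∈ A ×ˢ B
    · rw [indicator_of_mem hz, hval z hz]
      exact ENNReal.ofReal_le_ofReal (div_le_div_of_nonneg_right (h _ hz.1 _ hz.2).1 hmp.le)
    · rw [indicator_of_notMem hz]; exact zero_le
  · rw [← hint hi]
    refine lintegral_mono fun z => ?_
    by_cases hz : z ∈ A ×ˢ B
    · rw [indicator_of_mem hz, hval z hz]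
      exact ENNReal.ofReal_le_ofReal (div_le_div_of_nonneg_right (h _ hz.1 _ hz.2).2 hmp.le)
    · rw [hval0 z hz]; simp

lemma sum_toReal_localEnergy {u : Plane → ℝ} (hE : localEnergy u ≠ ∞) (n : ℕ) :
    ∑ w : Fin n → Fin 3, (localEnergy (u ∘ wordMap (List.ofFn w))).toReal =
      (3 / 5) ^ n * (localEnergy u).toReal := by
  rw [← ENNReal.toReal_sum fun w _ => localEnergy_wordMap_ne_top hE _, sum_localEnergy_wordMap,
    ENNReal.toReal_mul, toReal_three_div_five_pow]

/-- The pairs `p = q` contribute nothing to the squares, and every word has six ordered pairs `p ≠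
q`. Squares and cell energies both carry the factor `(3/5)ⁿ`, so the error is relative to the same
scale at every level. -/
lemma sum_affine_sq_sub {u : Plane → ℝ} (hE : localEnergy u ≠ ∞) (n : ℕ) (a b : ℝ) :
    ∑ w : Fin n → Fin 3, ∑ j : Fin 3, ∑ k ∈ Finset.univ.filter (fun k : Fin 3 => k ≠ j),
      (a * (u (wordMap (List.ofFn w) (corner j)) - u (wordMap (List.ofFn w) (corner k))) ^ 2 +
        b * (localEnergy (u ∘ wordMap (List.ofFn w))).toReal) =
      (3 / 5) ^ n * (a * discreteEnergy n u + b * (6 * (localEnergy u).toReal)) := by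
  have h1 : (3 / 5 : ℝ) ^ n * discreteEnergy n u = ∑ w : Fin n → Fin 3, ∑ j : Fin 3, ∑ k : Fin 3,
      (u (wordMap (List.ofFn w) (corner j)) - u (wordMap (List.ofFn w) (corner k))) ^ 2 := by
    rw [discreteEnergy, ← mul_assoc, ← mul_pow]; norm_num
  rw [mul_add, mul_left_comm, h1, mul_left_comm, mul_left_comm _ (6 : ℝ),
    ← sum_toReal_localEnergy hE, Finset.mul_sum, Finset.mul_sum, Finset.mul_sum,
    ← Finset.sum_add_distrib]
  refine Finset.sum_congr rfl fun w _ => ?_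
  simp only [Finset.sum_filter, Fin.sum_univ_three]
  simp
  ring

lemma ofReal_sum_le_sum_ofReal {ι : Type*} (s : Finset ι) (f : ι → ℝ) :
    ENNReal.ofReal (∑ i ∈ s, f i) ≤ ∑ i ∈ s, ENNReal.ofReal (f i) :=
  Finset.le_sum_of_subadditive ENNReal.ofReal ENNReal.ofReal_zero.le
    (fun _ _ => ENNReal.ofReal_add_le) s f

/-- Comparison of the level energies with the discrete energies. -/
lemma levelEnergy_bounds {u : Plane → ℝ} (hu : Continuous u) (hE : localEnergy u ≠ ∞)
    {γ i n : ℕ} (hγ : 1 ≤ γ) (hn : 1 ≤ n) (hi : 2 ≤ i) {β : ℝ} (hβ0 : 0 ≤ hdim + β)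
    (hβ : hdim + β ≤ 5) {ε : ℝ} (hε : 0 < ε) :
    ENNReal.ofReal ((2 ^ β / 5) ^ n * (((1 - ε) * discreteEnergy n u -
      1 / ε * (600 * (3 / 5) ^ i * (localEnergy u).toReal)) / (1 + 2 * (1 / 2) ^ i) ^ 5)) ≤
        levelEnergy γ i β u n ∧
    levelEnergy γ i β u n ≤ ENNReal.ofReal ((2 ^ β / 5) ^ n * (((1 + ε) * discreteEnergy n u +
      (1 + 1 / ε) * (600 * (3 / 5) ^ i * (localEnergy u).toReal)) /
        (1 - 2 * (1 / 2) ^ i) ^ 5)) := by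
  set ρ : ℝ := 2 * (1 / 2) ^ i with hρdef
  have hρ0 : 0 ≤ ρ := by positivity
  -- The assumption `2 ≤ i` gives `ρ ≤ 1/2`, which keeps distances between the two small cells away
  -- from `0`.
  have hρ1 : ρ < 1 := by
    have : (1 / 2 : ℝ) ^ i ≤ (1 / 2) ^ 2 := pow_le_pow_of_le_one (by norm_num) (by norm_num) hi
    rw [hρdef]; linarith
  have hρ1' : 0 < 1 - ρ := by linarith
  set τ : ℝ := (2 ^ β / 5) ^ n * (5 / 3) ^ n with hτ
  have hτ0 : 0 ≤ τ := by positivity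
  set D : (Fin n → Fin 3) → Fin 3 → Fin 3 → ℝ := fun w j k =>
    (u (wordMap (List.ofFn w) (corner j)) - u (wordMap (List.ofFn w) (corner k))) ^ 2 with hD
  set e : (Fin n → Fin 3) → ℝ := fun w => (localEnergy (u ∘ wordMap (List.ofFn w))).toReal with he
  have key : ∀ w j, ∀ k ∈ Finset.univ.filter (fun k : Fin 3 => k ≠ j), _ := fun w j k hk =>
    lintegral_pairDensity_bounds γ i β u n w j k
      (lo := τ / (1 + ρ) ^ 5 * (1 - ε) * D w j k +
        (-(τ / (1 + ρ) ^ 5 * (1 / ε) * (100 * (3 / 5) ^ i))) * e w)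
      (hi := τ / (1 - ρ) ^ 5 * (1 + ε) * D w j k +
        τ / (1 - ρ) ^ 5 * (1 + 1 / ε) * (100 * (3 / 5) ^ i) * e w)
      fun x hx y hy => by
        have h1 := sq_sub_bounds hu hE hγ hn hx hy hε
        have h2 := div_rpow_bounds (abs_dist_sub_le_of_mem_cornerCell hγ hn
          (Finset.mem_filter.1 hk).2.symm hx hy) hρ0 hρ1 hβ0 hβ (sq_nonneg (u x - u y))
        have hp : (0 : ℝ) ≤ 2 ^ (-2 * hdim * (n : ℝ)) := by positivity
        have h3 := mul_le_mul_of_nonneg_left h2.1 hp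
        have h4 := mul_le_mul_of_nonneg_left h2.2 hp
        rw [← mul_assoc, two_rpow_scale, ← hτ] at h3 h4
        constructor
        · refine le_trans ?_ h3
          have := mul_le_mul_of_nonneg_left h1.1 (by positivity : 0 ≤ τ / (1 + ρ) ^ 5)
          calc _ = τ / (1 + ρ) ^ 5 * ((1 - ε) * D w j k - 1 / ε * (100 * ((3 / 5) ^ i * e w))) := by
                ring
            _ ≤ _ := this
            _ = _ := by ring
        · refine h4.trans ?_
          have := mul_le_mul_of_nonneg_left h1.2 (by positivity : 0 ≤ τ / (1 - ρ) ^ 5)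
          calc _ = τ / (1 - ρ) ^ 5 * (u x - u y) ^ 2 := by ring
            _ ≤ _ := this
            _ = τ / (1 - ρ) ^ 5 * ((1 + ε) * D w j k + (1 + 1 / ε) * (100 * ((3 / 5) ^ i * e w))) :=
                rfl
            _ = _ := by ring
  have hcancel : (5 / 3 : ℝ) ^ n * (3 / 5) ^ n = 1 := by rw [← mul_pow]; norm_num
  constructor
  · calc _ = ENNReal.ofReal (∑ w : Fin n → Fin 3, ∑ j : Fin 3,
          ∑ k ∈ Finset.univ.filter (fun k : Fin 3 => k ≠ j), (τ / (1 + ρ) ^ 5 * (1 - ε) * D w j k +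
          (-(τ / (1 + ρ) ^ 5 * (1 / ε) * (100 * (3 / 5) ^ i))) * e w)) := by
          rw [sum_affine_sq_sub hE, hτ]
          congr 1
          linear_combination (-((2 ^ β / 5) ^ n * (((1 - ε) * discreteEnergy n u -
            1 / ε * (600 * (3 / 5) ^ i * (localEnergy u).toReal)) / (1 + ρ) ^ 5))) * hcancel
      _ ≤ _ := by
          refine le_trans ?_ (Finset.sum_le_sum fun w _ => Finset.sum_le_sum fun j _ =>
            Finset.sum_le_sum fun k hk => (key w j k hk).1)
          refine (ofReal_sum_le_sum_ofReal _ _).trans (Finset.sum_le_sum fun w _ => ?_)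
          refine (ofReal_sum_le_sum_ofReal _ _).trans (Finset.sum_le_sum fun j _ => ?_)
          exact ofReal_sum_le_sum_ofReal _ _
  · have hnn : ∀ w j k, 0 ≤ τ / (1 - ρ) ^ 5 * (1 + ε) * D w j k +
        τ / (1 - ρ) ^ 5 * (1 + 1 / ε) * (100 * (3 / 5) ^ i) * e w := fun w j k => by
      have h1 : 0 ≤ D w j k := sq_nonneg _
      have h2 : 0 ≤ e w := ENNReal.toReal_nonneg
      positivity
    calc _ ≤ ENNReal.ofReal (∑ w : Fin n → Fin 3, ∑ j : Fin 3,
          ∑ k ∈ Finset.univ.filter (fun k : Fin 3 => k ≠ j), (τ / (1 - ρ) ^ 5 * (1 + ε) * D w j k +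
          τ / (1 - ρ) ^ 5 * (1 + 1 / ε) * (100 * (3 / 5) ^ i) * e w)) := by
          refine (Finset.sum_le_sum fun w _ => Finset.sum_le_sum fun j _ =>
            Finset.sum_le_sum fun k hk => (key w j k hk).2).trans_eq ?_
          rw [ENNReal.ofReal_sum_of_nonneg fun w _ => Finset.sum_nonneg fun j _ =>
            Finset.sum_nonneg fun k _ => hnn w j k]
          refine Finset.sum_congr rfl fun w _ => ?_
          rw [ENNReal.ofReal_sum_of_nonneg fun j _ => Finset.sum_nonneg fun k _ => hnn w j k]
          refine Finset.sum_congr rfl fun j _ => ?_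
          rw [ENNReal.ofReal_sum_of_nonneg fun k _ => hnn w j k]
      _ = _ := by
          rw [sum_affine_sq_sub hE, hτ]
          congr 1
          linear_combination ((2 ^ β / 5) ^ n * (((1 + ε) * discreteEnergy n u +
            (1 + 1 / ε) * (600 * (3 / 5) ^ i * (localEnergy u).toReal)) / (1 - ρ) ^ 5)) * hcancel

/-! ### Splitting the non-local energy into level energies and a constant part -/

lemma jumpEnergy_eq (a : Plane → Plane → ℝ) (β : ℝ) (u : Plane → ℝ) :
    jumpEnergy a β u = ∫⁻ z : Plane × Plane, ENNReal.ofReal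
      (a z.1 z.2 * ((u z.1 - u z.2) ^ 2 / dist z.1 z.2 ^ (hdim + β)))
        ∂(hausdorffProb.prod hausdorffProb) := by
  rw [jumpEnergy, ← lintegral_indicator
    ((measurableSet_gasket.prod measurableSet_gasket).diff measurableSet_diagonal)]
  have h1 : ∀ᵐ z ∂(hausdorffProb.prod hausdorffProb), z.1 ∈ gasket :=
    Measure.quasiMeasurePreserving_fst.ae ae_mem_gasket
  have h2 : ∀ᵐ z ∂(hausdorffProb.prod hausdorffProb), z.2 ∈ gasket :=
    Measure.quasiMeasurePreserving_snd.ae ae_mem_gasket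
  refine lintegral_congr_ae ?_
  filter_upwards [h1, h2] with z hz1 hz2
  -- Removing the diagonal is harmless, as the numerator vanishes there.
  by_cases hz : z ∈ diagonal Plane
  · rw [indicator_of_notMem fun h => h.2 hz, show z.1 = z.2 from hz]; simp
  · have hmem : z ∈ (gasket ×ˢ gasket) \ diagonal Plane := ⟨⟨hz1, hz2⟩, hz⟩
    rw [indicator_of_mem hmem, mul_div_assoc]

lemma vertexKernel_mul (γ N i : ℕ) (β : ℝ) (u : Plane → ℝ) (x y : Plane) :
    vertexKernel γ N i x y * ((u x - u y) ^ 2 / dist x y ^ (hdim + β)) =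
      ∑ n ∈ Finset.Icc 1 N, ∑ w : Fin n → Fin 3, ∑ j : Fin 3,
        ∑ k ∈ Finset.univ.filter (fun k : Fin 3 => k ≠ j), pairDensity γ i β u n w j k x y := by
  simp only [vertexKernel, pairDensity, Finset.sum_mul, Finset.mul_sum]

lemma vertexKernel_nonneg (γ N i : ℕ) (x y : Plane) : 0 ≤ vertexKernel γ N i x y := by
  have : ∀ (s : Set Plane) (x : Plane), 0 ≤ s.indicator (fun _ => (1 : ℝ)) x := fun s x =>
    indicator_nonneg (fun _ _ => zero_le_one) x
  unfold vertexKernel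
  refine Finset.sum_nonneg fun n _ => mul_nonneg (by positivity) (Finset.sum_nonneg fun w _ =>
    Finset.sum_nonneg fun j _ => Finset.sum_nonneg fun k _ => ?_)
  exact mul_nonneg (by positivity) (mul_nonneg (this _ _) (this _ _))

lemma jumpEnergy_jumpKernel (γ N i : ℕ) {δ : ℝ} (hδ0 : 0 ≤ δ) (hδ1 : δ ≤ 1) (β : ℝ) {u : Plane → ℝ}
    (hu : Continuous u) :
    jumpEnergy (jumpKernel γ N i δ) β u =
      ENNReal.ofReal δ * ∑ n ∈ Finset.Icc 1 N, levelEnergy γ i β u n +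
      ENNReal.ofReal (1 - δ) * ∫⁻ x, ∫⁻ y, ENNReal.ofReal
        ((u x - u y) ^ 2 / dist x y ^ (hdim + β)) ∂hausdorffProb ∂hausdorffProb := by
  have hm := (measurable_div_dist_rpow hu (hdim + β)).ennreal_ofReal
  have hp := fun n w j k => (measurable_pairDensity γ i β hu n w j k).ennreal_ofReal
  have hsplit : ∀ z : Plane × Plane, ENNReal.ofReal (jumpKernel γ N i δ z.1 z.2 *
      ((u z.1 - u z.2) ^ 2 / dist z.1 z.2 ^ (hdim + β))) =
      ENNReal.ofReal δ * ∑ n ∈ Finset.Icc 1 N, ∑ w : Fin n → Fin 3, ∑ j : Fin 3,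
        ∑ k ∈ Finset.univ.filter (fun k : Fin 3 => k ≠ j),
          ENNReal.ofReal (pairDensity γ i β u n w j k z.1 z.2) +
      ENNReal.ofReal (1 - δ) * ENNReal.ofReal
        ((u z.1 - u z.2) ^ 2 / dist z.1 z.2 ^ (hdim + β)) := fun z => by
    have hnn := fun n w j k => pairDensity_nonneg γ i β u n w j k z.1 z.2
    rw [jumpKernel, add_mul, mul_assoc, ENNReal.ofReal_add
      (mul_nonneg hδ0 (mul_nonneg (vertexKernel_nonneg γ N i z.1 z.2) (by positivity)))
      (mul_nonneg (sub_nonneg.2 hδ1) (by positivity)), ENNReal.ofReal_mul hδ0,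
      ENNReal.ofReal_mul (sub_nonneg.2 hδ1), vertexKernel_mul,
      ENNReal.ofReal_sum_of_nonneg fun n _ => Finset.sum_nonneg fun w _ => Finset.sum_nonneg
        fun j _ => Finset.sum_nonneg fun k _ => hnn n w j k]
    congr 2
    refine Finset.sum_congr rfl fun n _ => ?_
    rw [ENNReal.ofReal_sum_of_nonneg fun w _ => Finset.sum_nonneg
        fun j _ => Finset.sum_nonneg fun k _ => hnn n w j k]
    refine Finset.sum_congr rfl fun w _ => ?_
    rw [ENNReal.ofReal_sum_of_nonneg fun j _ => Finset.sum_nonneg fun k _ => hnn n w j k]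
    refine Finset.sum_congr rfl fun j _ => ?_
    rw [ENNReal.ofReal_sum_of_nonneg fun k _ => hnn n w j k]
  have hj := fun n w j => Finset.measurable_fun_sum (Finset.univ.filter (fun k : Fin 3 => k ≠ j))
    fun k _ => hp n w j k
  have hw := fun n w => Finset.measurable_fun_sum Finset.univ fun j _ => hj n w j
  have hn := fun n => Finset.measurable_fun_sum Finset.univ fun w _ => hw n w
  rw [jumpEnergy_eq]
  simp only [hsplit]
  rw [lintegral_add_right _ (hm.const_mul _), lintegral_const_mul _ hm, lintegral_const_mul _
    (Finset.measurable_fun_sum _ fun n _ => hn n), lintegral_prod _ hm.aemeasurable,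
    lintegral_finsetSum _ fun n _ => hn n]
  congr 2
  refine Finset.sum_congr rfl fun n _ => ?_
  rw [lintegral_finsetSum _ fun w _ => hw n w, levelEnergy]
  refine Finset.sum_congr rfl fun w _ => ?_
  rw [lintegral_finsetSum _ fun j _ => hj n w j]
  refine Finset.sum_congr rfl fun j _ => ?_
  rw [lintegral_finsetSum _ fun k _ => hp n w j k]

/-! ### Abelian means and the limit -/

lemma sum_Icc_one_sub_mul_pow_le_one {x : ℝ} (h0 : 0 ≤ x) (h1 : x < 1) (N : ℕ) :
    ∑ n ∈ Finset.Icc 1 N, (1 - x) * x ^ n ≤ 1 := by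
  have h := geom_sum_Ico_mul x (Nat.le_add_left 1 N)
  rw [← Finset.mul_sum, ← Finset.Ico_add_one_right_eq_Icc]
  have : 0 ≤ x ^ (N + 1) := by positivity
  linarith

/-- The weights `(1 - x) xⁿ` have total mass at most `1`, which gives the upper bound. For the lower
bound only `n ≥ m` is kept and `D n` is replaced by `D m`; these weights sum to `x^m - x^(Φ+1)`,
which tends to `1`. -/
lemma tendsto_sum_one_sub_mul_pow_mul {D : ℕ → ℝ} {E : ℝ} (hmono : Monotone D) (h0 : ∀ n, 0 ≤ D n)
    (hD : Tendsto D atTop (𝓝 E)) {x : ℕ → ℝ} {Φ : ℕ → ℕ} (hx : ∀ i, 1 ≤ i → 0 ≤ x i ∧ x i < 1)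
    (hx1 : Tendsto x atTop (𝓝 1)) (hΦ : ∀ i : ℕ, 1 ≤ i → (i : ℝ) ≤ (1 - x i) * (Φ i : ℝ)) :
    Tendsto (fun i => ∑ n ∈ Finset.Icc 1 (Φ i), (1 - x i) * x i ^ n * D n) atTop (𝓝 E) := by
  have hDE : ∀ n, D n ≤ E := fun n => hmono.ge_of_tendsto hD n
  have hE : 0 ≤ E := (h0 0).trans (hDE 0)
  refine tendsto_order.2 ⟨fun a ha => ?_, fun b hb => ?_⟩
  · obtain ⟨m, hm1, hm⟩ := ((eventually_ge_atTop 1).and (hD.eventually (lt_mem_nhds ha))).exists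
    have hlim : Tendsto (fun i : ℕ => (x i ^ m - Real.exp (-(i : ℝ))) * D m) atTop
        (𝓝 ((1 ^ m - 0) * D m)) :=
      ((hx1.pow m).sub (Real.tendsto_exp_neg_atTop_nhds_zero.comp
        tendsto_natCast_atTop_atTop)).mul_const _
    rw [one_pow, sub_zero, one_mul] at hlim
    filter_upwards [hlim.eventually (lt_mem_nhds hm), eventually_ge_atTop (max 1 m)] with i hi him
    obtain ⟨h1i, hmi⟩ := max_le_iff.1 him
    obtain ⟨hx0, hxl⟩ := hx i h1i
    have hΦi := hΦ i h1i
    have hiΦ : i ≤ Φ i := by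
      have : (1 - x i) * (Φ i : ℝ) ≤ 1 * Φ i := by gcongr; linarith
      exact_mod_cast hΦi.trans (this.trans_eq (one_mul _))
    -- Here the growth condition on `Φ` enters: `x^Φ ≤ exp(-(1 - x) Φ) ≤ exp(-i)`.
    have hexp : x i ^ (Φ i + 1) ≤ Real.exp (-(i : ℝ)) := by
      calc x i ^ (Φ i + 1) ≤ x i ^ Φ i := pow_le_pow_of_le_one hx0 hxl.le (Nat.le_succ _)
        _ ≤ Real.exp (-(1 - x i)) ^ Φ i := by
            gcongr
            linarith [Real.add_one_le_exp (-(1 - x i))]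
        _ = Real.exp (-((1 - x i) * Φ i)) := by rw [← Real.exp_nat_mul]; ring_nf
        _ ≤ _ := Real.exp_le_exp.2 (neg_le_neg hΦi)
    have hg := geom_sum_Ico_mul (x i) (by omega : m ≤ Φ i + 1)
    calc a < (x i ^ m - Real.exp (-(i : ℝ))) * D m := hi
      _ ≤ (x i ^ m - x i ^ (Φ i + 1)) * D m := by
          have := h0 m
          gcongr
      _ = ∑ n ∈ Finset.Ico m (Φ i + 1), (1 - x i) * x i ^ n * D m := by
          rw [← Finset.sum_mul, ← Finset.mul_sum]
          congr 1
          linarith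
      _ ≤ ∑ n ∈ Finset.Ico m (Φ i + 1), (1 - x i) * x i ^ n * D n := by
          refine Finset.sum_le_sum fun n hn => mul_le_mul_of_nonneg_left
            (hmono (Finset.mem_Ico.1 hn).1) (mul_nonneg (by linarith) (by positivity))
      _ ≤ _ := by
          rw [← Finset.Ico_add_one_right_eq_Icc]
          exact Finset.sum_le_sum_of_subset_of_nonneg (Finset.Ico_subset_Ico_left hm1)
            fun n _ _ => mul_nonneg (mul_nonneg (by linarith) (by positivity)) (h0 n)
  · filter_upwards [eventually_ge_atTop 1] with i h1i
    obtain ⟨hx0, hxl⟩ := hx i h1i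
    refine lt_of_le_of_lt ?_ hb
    calc _ ≤ ∑ n ∈ Finset.Icc 1 (Φ i), (1 - x i) * x i ^ n * E :=
          Finset.sum_le_sum fun n _ => mul_le_mul_of_nonneg_left (hDE n)
            (mul_nonneg (by linarith) (by positivity))
      _ ≤ 1 * E := by
          rw [← Finset.sum_mul]
          gcongr
          exact sum_Icc_one_sub_mul_pow_le_one hx0 hxl _
      _ = E := one_mul E

/-- With `walkDim_le_three` this keeps `α + β` below `5`, so that the errors in the distances can be
raised to a fixed integer power. -/
lemma hdim_le_two : hdim ≤ 2 := by
  rw [hdim, div_le_iff₀ (Real.log_pos (by norm_num))]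
  calc Real.log 3 ≤ Real.log (2 ^ 2) := Real.log_le_log (by norm_num) (by norm_num)
    _ = _ := by rw [Real.log_pow]; norm_num

lemma walkDim_le_three : walkDim ≤ 3 := by
  rw [walkDim, div_le_iff₀ (Real.log_pos (by norm_num))]
  calc Real.log 5 ≤ Real.log (2 ^ 3) := Real.log_le_log (by norm_num) (by norm_num)
    _ = _ := by rw [Real.log_pow]; norm_num

lemma two_rpow_walkDim : (2 : ℝ) ^ walkDim = 5 := by
  rw [walkDim, Real.log_div_log, Real.rpow_logb] <;> norm_num

lemma two_rpow_div_five_lt_one {β : ℝ} (h : β < walkDim) : (2 : ℝ) ^ β / 5 < 1 := by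
  rw [div_lt_one (by norm_num), ← two_rpow_walkDim]
  exact Real.rpow_lt_rpow_of_exponent_lt (by norm_num) h

lemma tendsto_two_rpow_div_five {β : ℕ → ℝ} (h : Tendsto β atTop (𝓝 walkDim)) :
    Tendsto (fun i => (2 : ℝ) ^ β i / 5) atTop (𝓝 1) := by
  have := ((Real.continuous_const_rpow (two_ne_zero (α := ℝ))).tendsto walkDim |>.comp h).div_const 5
  rwa [two_rpow_walkDim, div_self (by norm_num)] at this

lemma tendsto_discreteEnergy {u : Plane → ℝ} (hE : localEnergy u ≠ ∞) :
    Tendsto (fun n => discreteEnergy n u) atTop (𝓝 (localEnergy u).toReal) := by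
  have h := (ENNReal.tendsto_toReal hE).comp (tendsto_localEnergy u)
  exact h.congr fun n => ENNReal.toReal_ofReal (discreteEnergy_nonneg n u)

/-- The sum of the level energies, multiplied by `1 - 2^β / 5`, is close to the Abelian mean of the
discrete energies. -/
lemma sum_levelEnergy_bounds {u : Plane → ℝ} (hu : Continuous u) (hE : localEnergy u ≠ ∞)
    {γ i : ℕ} (hγ : 1 ≤ γ) (hi : 2 ≤ i) {β : ℝ} (hβ : β ∈ Ioo hdim walkDim) (N : ℕ)
    {ε : ℝ} (hε : 0 < ε) :
    ENNReal.ofReal (((1 - ε) * (∑ n ∈ Finset.Icc 1 N, (1 - 2 ^ β / 5) * (2 ^ β / 5) ^ n *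
        discreteEnergy n u) - 1 / ε * (600 * (3 / 5) ^ i * (localEnergy u).toReal)) /
          (1 + 2 * (1 / 2) ^ i) ^ 5) ≤
      ENNReal.ofReal (1 - 2 ^ β / 5) * ∑ n ∈ Finset.Icc 1 N, levelEnergy γ i β u n ∧
    ENNReal.ofReal (1 - 2 ^ β / 5) * ∑ n ∈ Finset.Icc 1 N, levelEnergy γ i β u n ≤
      ENNReal.ofReal (((1 + ε) * (∑ n ∈ Finset.Icc 1 N, (1 - 2 ^ β / 5) * (2 ^ β / 5) ^ n *
        discreteEnergy n u) + (1 + 1 / ε) * (600 * (3 / 5) ^ i * (localEnergy u).toReal)) /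
          (1 - 2 * (1 / 2) ^ i) ^ 5) := by
  have hx0 : (0 : ℝ) ≤ 2 ^ β / 5 := by positivity
  have hx1 := two_rpow_div_five_lt_one hβ.2
  have hsum := sum_Icc_one_sub_mul_pow_le_one hx0 hx1 N
  have hs0 : 0 ≤ hdim + β := by linarith [hdim_pos, hβ.1]
  have hs5 : hdim + β ≤ 5 := by linarith [hdim_le_two, walkDim_le_three, hβ.2]
  have key := fun n (hn : n ∈ Finset.Icc 1 N) =>
    levelEnergy_bounds hu hE hγ (Finset.mem_Icc.1 hn).1 hi hs0 hs5 hε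
  have hρ1 : 0 < 1 - 2 * (1 / 2 : ℝ) ^ i := by
    have : (1 / 2 : ℝ) ^ i ≤ (1 / 2) ^ 2 := pow_le_pow_of_le_one (by norm_num) (by norm_num) hi
    linarith
  set x : ℝ := 2 ^ β / 5
  set E := (localEnergy u).toReal
  have hE0 : 0 ≤ E := ENNReal.toReal_nonneg
  have hx1' : 0 ≤ 1 - x := by linarith
  constructor
  · refine le_trans ?_ (mul_le_mul_right (Finset.sum_le_sum fun n hn => (key n hn).1) _)
    refine le_trans ?_ (mul_le_mul_right (ofReal_sum_le_sum_ofReal _ _) _)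
    rw [← ENNReal.ofReal_mul hx1']
    refine ENNReal.ofReal_le_ofReal ?_
    calc _ ≤ ((1 - ε) * (∑ n ∈ Finset.Icc 1 N, (1 - x) * x ^ n * discreteEnergy n u) -
          (∑ n ∈ Finset.Icc 1 N, (1 - x) * x ^ n) * (1 / ε * (600 * (3 / 5) ^ i * E))) /
          (1 + 2 * (1 / 2) ^ i) ^ 5 := by
          exact div_le_div_of_nonneg_right (sub_le_sub_left
            (mul_le_of_le_one_left (by positivity) hsum) _) (by positivity)
      _ = _ := by
          rw [Finset.mul_sum, Finset.sum_mul, ← Finset.sum_sub_distrib, Finset.sum_div,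
            Finset.mul_sum]
          exact Finset.sum_congr rfl fun n _ => by ring
  · refine (mul_le_mul_right (Finset.sum_le_sum fun n hn => (key n hn).2) _).trans ?_
    rw [← ENNReal.ofReal_sum_of_nonneg fun n _ => by
      have := discreteEnergy_nonneg n u
      positivity]
    rw [← ENNReal.ofReal_mul hx1']
    refine ENNReal.ofReal_le_ofReal ?_
    calc _ = ((1 + ε) * (∑ n ∈ Finset.Icc 1 N, (1 - x) * x ^ n * discreteEnergy n u) +
          (∑ n ∈ Finset.Icc 1 N, (1 - x) * x ^ n) * ((1 + 1 / ε) * (600 * (3 / 5) ^ i * E))) /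
          (1 - 2 * (1 / 2) ^ i) ^ 5 := by
          rw [Finset.mul_sum, Finset.mul_sum, Finset.sum_mul, ← Finset.sum_add_distrib,
            Finset.sum_div]
          exact Finset.sum_congr rfl fun n _ => by ring
      _ ≤ _ := div_le_div_of_nonneg_right (add_le_add_right
          (mul_le_of_le_one_left (by positivity) hsum) _) (by positivity)

lemma tendsto_jumpEnergy_of_continuous {γ : ℕ} (hγ : 1 ≤ γ) {β : ℕ → ℝ}
    (hβ : ∀ i : ℕ, 1 ≤ i → β i ∈ Ioo hdim walkDim) (hβ_lim : Tendsto β atTop (𝓝 walkDim))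
    {δ : ℕ → ℝ} (hδ : ∀ i : ℕ, 1 ≤ i → δ i ∈ Ioo (0 : ℝ) 1) (hδ_lim : Tendsto δ atTop (𝓝 1))
    {Φ : ℕ → ℕ} (hΦ : ∀ i : ℕ, 1 ≤ i → (i : ℝ) ≤ (1 - (2 : ℝ) ^ β i / 5) * (Φ i : ℝ))
    {u : Plane → ℝ} (hu : Continuous u) (hE : localEnergy u ≠ ∞) :
    Tendsto (fun i : ℕ => ENNReal.ofReal (1 - (2 : ℝ) ^ β i / 5) *
      jumpEnergy (jumpKernel γ (Φ i) i (δ i)) (β i) u) atTop (𝓝 (localEnergy u)) := by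
  set E := (localEnergy u).toReal with hEdef
  have hE0 : 0 ≤ E := ENNReal.toReal_nonneg
  set S : ℕ → ℝ := fun i => ∑ n ∈ Finset.Icc 1 (Φ i),
    (1 - 2 ^ β i / 5) * (2 ^ β i / 5) ^ n * discreteEnergy n u with hS
  have hSlim : Tendsto S atTop (𝓝 E) :=
    tendsto_sum_one_sub_mul_pow_mul (discreteEnergy_mono u) (fun n => discreteEnergy_nonneg n u)
      (tendsto_discreteEnergy hE) (fun i hi => ⟨by positivity, two_rpow_div_five_lt_one (hβ i hi).2⟩)
      (tendsto_two_rpow_div_five hβ_lim) hΦ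
  have hgeom : ∀ r : ℝ, 0 ≤ r → r < 1 → Tendsto (fun i : ℕ => r ^ i) atTop (𝓝 0) := fun r h0 h1 =>
    tendsto_pow_atTop_nhds_zero_of_lt_one h0 h1
  -- The error parameter is `ε = (4/5)^i`: it tends to `0`, yet slowly enough that `(3/5)^i / ε =
  -- (3/4)^i` does too.
  have h45 := hgeom (4 / 5) (by norm_num) (by norm_num)
  have h34 := hgeom (3 / 4) (by norm_num) (by norm_num)
  have h35 := hgeom (3 / 5) (by norm_num) (by norm_num)
  have h12 := hgeom (1 / 2) (by norm_num) (by norm_num)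
  have hquot : ∀ i : ℕ, 1 / (4 / 5 : ℝ) ^ i * (3 / 5) ^ i = (3 / 4) ^ i := fun i => by
    rw [one_div, ← inv_pow, ← mul_pow]; norm_num
  have hlo : Tendsto (fun i : ℕ => δ i * (((1 - (4 / 5) ^ i) * S i -
      1 / (4 / 5) ^ i * (600 * (3 / 5) ^ i * E)) / (1 + 2 * (1 / 2) ^ i) ^ 5)) atTop (𝓝 E) := by
    have h := hδ_lim.mul ((((h45.const_sub 1).mul hSlim).sub (h34.mul_const (600 * E))).div
      (((h12.const_mul 2).const_add 1).pow 5) (by norm_num))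
    refine Tendsto.congr (fun i => ?_) (h.trans_eq (by norm_num))
    simp only [Pi.div_apply, ← hquot i]; ring
  have hup : Tendsto (fun i : ℕ => δ i * (((1 + (4 / 5) ^ i) * S i +
      (1 + 1 / (4 / 5) ^ i) * (600 * (3 / 5) ^ i * E)) / (1 - 2 * (1 / 2) ^ i) ^ 5) +
      (1 - δ i) * (1372500 * E)) atTop (𝓝 E) := by
    have h := (hδ_lim.mul ((((h45.const_add 1).mul hSlim).add
      ((h35.mul_const (600 * E)).add (h34.mul_const (600 * E)))).div
      (((h12.const_mul 2).const_sub 1).pow 5) (by norm_num))).add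
      ((hδ_lim.const_sub 1).mul_const (1372500 * E))
    refine Tendsto.congr (fun i => ?_) (h.trans_eq (by norm_num))
    simp only [Pi.div_apply, ← hquot i]; ring
  rw [← ENNReal.ofReal_toReal hE, ← hEdef]
  refine tendsto_of_tendsto_of_tendsto_of_le_of_le' (ENNReal.tendsto_ofReal hlo)
    (ENNReal.tendsto_ofReal hup) ?_ ?_
  all_goals
    filter_upwards [eventually_ge_atTop 2] with i hi
    have h1i : 1 ≤ i := by omega
    obtain ⟨hδ0, hδ1⟩ := hδ i h1i
    have hb := sum_levelEnergy_bounds hu hE hγ hi (hβ i h1i) (Φ i)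
      (by positivity : (0 : ℝ) < (4 / 5) ^ i)
    rw [jumpEnergy_jumpKernel γ (Φ i) i hδ0.le hδ1.le (β i) hu, mul_add,
      mul_left_comm _ (ENNReal.ofReal (δ i)), mul_left_comm _ (ENNReal.ofReal (1 - δ i))]
  -- The lower bound discards the constant part of the coefficient.
  · rw [ENNReal.ofReal_mul hδ0.le]
    exact (mul_le_mul_right hb.1 _).trans le_self_add
  · have hS0 : 0 ≤ S i := Finset.sum_nonneg fun n _ => mul_nonneg (mul_nonneg
      (sub_nonneg.2 (two_rpow_div_five_lt_one (hβ i h1i).2).le) (by positivity))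
      (discreteEnergy_nonneg n u)
    have hρ1 : 0 < 1 - 2 * (1 / 2 : ℝ) ^ i := by
      have : (1 / 2 : ℝ) ^ i ≤ (1 / 2) ^ 2 := pow_le_pow_of_le_one (by norm_num) (by norm_num) hi
      linarith
    have hδ1' : 0 ≤ 1 - δ i := by linarith
    rw [ENNReal.ofReal_add (by positivity) (by positivity), ENNReal.ofReal_mul hδ0.le,
      ENNReal.ofReal_mul hδ1']
    refine add_le_add (mul_le_mul_right hb.2 _) (mul_le_mul_right ?_ _)
    refine (lintegral_div_dist_rpow_le hu (hdim_pos.le.trans (hβ i h1i).1.le)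
      (two_rpow_div_five_lt_one (hβ i h1i).2)).trans_eq ?_
    rw [ENNReal.ofReal_mul (by norm_num), hEdef, ENNReal.ofReal_toReal hE]
    simp

/-! ### Reduction to functions that are continuous on the plane, and the coefficient bounds -/

lemma discreteEnergy_congr {u v : Plane → ℝ} (h : EqOn u v gasket) (n : ℕ) :
    discreteEnergy n u = discreteEnergy n v := by
  have : ∀ (w : Fin n → Fin 3) j, u (wordMap (List.ofFn w) (corner j)) =
      v (wordMap (List.ofFn w) (corner j)) := fun w j =>
    h (wordMap_mem_gasket _ (corner_mem_gasket j))
  simp only [discreteEnergy, this]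

lemma localEnergy_congr {u v : Plane → ℝ} (h : EqOn u v gasket) : localEnergy u = localEnergy v := by
  simp only [localEnergy, discreteEnergy_congr h]

lemma jumpEnergy_congr {u v : Plane → ℝ} (h : EqOn u v gasket) (a : Plane → Plane → ℝ) (β : ℝ) :
    jumpEnergy a β u = jumpEnergy a β v := by
  refine setLIntegral_congr_fun
    ((measurableSet_gasket.prod measurableSet_gasket).diff measurableSet_diagonal) fun z hz => ?_
  simp only [h hz.1.1, h hz.1.2]

/-- Tietze extension. Values off the gasket do not affect any of the energies, and global continuity
provides the measurability used in the integral estimates. -/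
lemma exists_continuous_eqOn {u : Plane → ℝ} (hu : ContinuousOn u gasket) :
    ∃ v : Plane → ℝ, Continuous v ∧ EqOn u v gasket := by
  obtain ⟨g, hg⟩ := ContinuousMap.exists_restrict_eq gasket_isCompact.isClosed
    (⟨gasket.domRestrict u, hu.domRestrict⟩ : C(gasket, ℝ))
  exact ⟨g, g.continuous, fun x hx => (DFunLike.congr_fun hg ⟨x, hx⟩).symm⟩

lemma exists_vertexKernel_le (γ N i : ℕ) : ∃ C : ℝ, ∀ x y, vertexKernel γ N i x y ≤ C := by
  refine ⟨∑ n ∈ Finset.Icc 1 N, (2 : ℝ) ^ (-2 * hdim * (n : ℝ)) *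
    ∑ w : Fin n → Fin 3, ∑ j : Fin 3, ∑ k ∈ Finset.univ.filter (fun k : Fin 3 => k ≠ j),
      1 / (hausdorffProb.real (cornerCell γ i w j) * hausdorffProb.real (cornerCell γ i w k)) *
        (1 * 1), fun x y => ?_⟩
  have h0 : ∀ (s : Set Plane) (x : Plane), 0 ≤ s.indicator (fun _ => (1 : ℝ)) x := fun s x =>
    indicator_nonneg (fun _ _ => zero_le_one) x
  have h1 : ∀ (s : Set Plane) (x : Plane), s.indicator (fun _ => (1 : ℝ)) x ≤ 1 := fun s x =>
    indicator_le_self' (fun _ _ => zero_le_one) x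
  unfold vertexKernel
  gcongr
  all_goals first | exact h0 _ _ | exact h1 _ _

lemma exists_jumpKernel_bounds (γ N i : ℕ) {δ : ℝ} (hδ : δ ∈ Ioo (0 : ℝ) 1) :
    ∃ c C : ℝ, 0 < c ∧ ∀ x ∈ gasket, ∀ y ∈ gasket,
      c ≤ jumpKernel γ N i δ x y ∧ jumpKernel γ N i δ x y ≤ C := by
  obtain ⟨C, hC⟩ := exists_vertexKernel_le γ N i
  refine ⟨1 - δ, δ * C + (1 - δ), by linarith [hδ.2], fun x _ y _ => ⟨?_, ?_⟩⟩
  · exact le_add_of_nonneg_left (mul_nonneg hδ.1.le (vertexKernel_nonneg γ N i x y))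
  · have := mul_le_mul_of_nonneg_left (hC x y) hδ.1.le
    unfold jumpKernel
    linarith

lemma exists_cutoff {β : ℕ → ℝ} (hβ : ∀ i : ℕ, 1 ≤ i → β i ∈ Ioo hdim walkDim)
    (hβ_mono : MonotoneOn β (Ici 1)) :
    ∃ Φ : ℕ → ℕ, MonotoneOn Φ (Ici 1) ∧
      ∀ i : ℕ, 1 ≤ i → (i : ℝ) ≤ (1 - (2 : ℝ) ^ β i / 5) * (Φ i : ℝ) := by
  have hpos : ∀ i : ℕ, 1 ≤ i → 0 < 1 - (2 : ℝ) ^ β i / 5 := fun i hi => by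
    linarith [two_rpow_div_five_lt_one (hβ i hi).2]
  -- The smallest admissible cutoff; it is monotone because the numerator grows and the denominator
  -- shrinks as `β i` increases.
  refine ⟨fun i => ⌈(i : ℝ) / (1 - (2 : ℝ) ^ β i / 5)⌉₊, fun i hi j hj hij => ?_, fun i hi => ?_⟩
  · refine Nat.ceil_mono (div_le_div₀ (by positivity) (by exact_mod_cast hij) (hpos j hj) ?_)
    have : (2 : ℝ) ^ β i ≤ 2 ^ β j :=
      Real.rpow_le_rpow_of_exponent_le (by norm_num) (hβ_mono hi hj hij)
    linarith
  · have := Nat.le_ceil ((i : ℝ) / (1 - (2 : ℝ) ^ β i / 5))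
    rwa [div_le_iff₀' (hpos i hi)] at this

end SierpinskiGasket

end

theorem mainTheorem10 (γ : ℕ) (hγ : 1 ≤ γ) (β : ℕ → ℝ)
    (hβ : ∀ i : ℕ, 1 ≤ i → β i ∈ Ioo SierpinskiGasket.hdim SierpinskiGasket.walkDim)
    (hβ_mono : MonotoneOn β (Ici 1))
    (hβ_lim : Tendsto β atTop (𝓝 SierpinskiGasket.walkDim)) :
    (∃ Φ : ℕ → ℕ, MonotoneOn Φ (Ici 1) ∧
      ∀ i : ℕ, 1 ≤ i → (i : ℝ) ≤ (1 - (2 : ℝ) ^ β i / 5) * (Φ i : ℝ)) ∧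
    ∀ δ : ℕ → ℝ, (∀ i : ℕ, 1 ≤ i → δ i ∈ Ioo (0 : ℝ) 1) → MonotoneOn δ (Ici 1) →
      Tendsto δ atTop (𝓝 1) →
    ∀ Φ : ℕ → ℕ, MonotoneOn Φ (Ici 1) →
      (∀ i : ℕ, 1 ≤ i → (i : ℝ) ≤ (1 - (2 : ℝ) ^ β i / 5) * (Φ i : ℝ)) →
      (∀ i : ℕ, 1 ≤ i → ∃ c C : ℝ, 0 < c ∧
        ∀ x ∈ SierpinskiGasket.gasket, ∀ y ∈ SierpinskiGasket.gasket,
          c ≤ SierpinskiGasket.jumpKernel γ (Φ i) i (δ i) x y ∧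
            SierpinskiGasket.jumpKernel γ (Φ i) i (δ i) x y ≤ C) ∧
      ∀ u ∈ SierpinskiGasket.localDomain,
        Tendsto (fun i : ℕ => ENNReal.ofReal (1 - (2 : ℝ) ^ β i / 5) *
            SierpinskiGasket.jumpEnergy
              (SierpinskiGasket.jumpKernel γ (Φ i) i (δ i)) (β i) u)
          atTop (𝓝 (SierpinskiGasket.localEnergy u)) := by
  refine ⟨SierpinskiGasket.exists_cutoff hβ hβ_mono, fun δ hδ _ hδ_lim Φ _ hΦ =>
    ⟨fun i hi => SierpinskiGasket.exists_jumpKernel_bounds γ (Φ i) i (hδ i hi), fun u hu => ?_⟩⟩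
  obtain ⟨v, hv, huv⟩ := SierpinskiGasket.exists_continuous_eqOn hu.1
  simp only [SierpinskiGasket.jumpEnergy_congr huv]
  rw [SierpinskiGasket.localEnergy_congr huv]
  refine SierpinskiGasket.tendsto_jumpEnergy_of_continuous hγ hβ hβ_lim hδ hδ_lim hΦ hv ?_
  rw [← SierpinskiGasket.localEnergy_congr huv]
  exact hu.2.ne
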